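/- Let $n,d\ge 1$ and let $f_1,\dots,f_n:\mathbb R^d\to\mathbb R$ be twice continuously differentiable with $\mu I\preceq\nabla^2 f_i(x)\preceq L I$ for all $x$ and $i$, where $0<\mu\le L$; put $\kappa=L/\mu$, $f=\frac1n\sum_i f_i$, $x^*=\arg\min f$, and let $\|\nabla f_i(x^*)\|_\infty\le c_*$ for all $i$. Let $\xi_i^t$ ($t\ge 0$, $1\le i\le n$) be random vectors in $\mathbb R^d$ such that the families $(\xi_i^t)_{i}$ are independent over $t$ (arbitrary dependence over nodes and components is allowed), and every component of every $\xi_i^t$ has the same marginal density $p$ on $\mathbb R$, with $p(u)=p(-u)$ for all $u$ and $\int|u|p(u)\,du\le\sigma$, where $\sigma>0$. Let $W=(w_{ij})\in\mathbb R^{n\times n}$ be a nonnegative doubly stochastic matrix supported on the diagonal and on the links of a strongly connected directed graph on the $n$ nodes, with $\|W-\mathbf 1\mathbf 1^\top/n\|_2<1$. SClip-EF-Network with parameters $\varphi_t,\epsilon_t,\beta_t,\eta_t$ starts from a common deterministic point $x_i^0=x^0\in\mathbb R^d$ and from $m_i^0=0$ and iterates, for every node $i$ and $t\ge0$, $$m_i^{t+1}=\beta_t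 m_i^t+(1-\beta_t)\,\Psi_t\big(\nabla f_i(x_i^t)+\xi_i^t-m_i^t\big),\qquad x_i^{t+1}=\sum_{j=1}^n w_{ij}\big(x_j^t-\eta_t m_j^{t+1}\big),$$ where $\Psi_t$ acts on each component as $y\mapsto \varphi_t\,y/\sqrt{y^2+\epsilon_t}$. Take $$\varphi_t=\frac{c_\varphi}{\sqrt{t+1}},\quad \epsilon_t=\tau(t+1)^{3/5},\quad \beta_t=\frac{c_\beta}{\sqrt{t+1}},\quad \eta_t=\frac{c_\eta}{(t+1)^{1/5}},\qquad c_\varphi,c_\eta>0,\ 0\le c_\beta<1.$$ **Theorem.** Let $0<a\le A$ and $0<b\le B$ be constants with $98A\le b$. There is a function $c_s=c_s(d,\kappa)$, depending only on $a,A,b,B$ and on $(d,\kappa)$, with $c_s=\Omega(d^{-1/2}\kappa^{-5/4})$, that is, $c_s(d,\kappa)\ge c\,d^{-1/2}\kappa^{-5/4}$ for all $d\ge1$, $\kappa\ge1$ and some $c>0$ depending only on $a,A,b,B$, such that the following holds in every setting as above. If $c_\eta^2c_\varphi^2=\Theta(\sigma^2/\mu^2)$ and $\tau=\Theta(d\sigma^2\kappa^{5/2})$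 with these constants, that is, $$a\,\frac{\sigma^2}{\mu^2}\le c_\eta^2c_\varphi^2\le A\,\frac{\sigma^2}{\mu^2},\qquad b\,d\sigma^2\kappa^{5/2}\le\tau\le B\,d\sigma^2\kappa^{5/2},$$ then for every node $i$ the expectations $\mathbb E\|x_i^t-x^*\|^2$ are finite, and for every $0<\delta<\min(c_s(d,\kappa),2/5)$, $$\lim_{t\to\infty}(t+1)^{\delta}\,\mathbb E\big[\|x_i^t-x^*\|^2\big]=0 .$$ -/

import Mathlib

open MeasureTheory ProbabilityTheory Filter Topology

namespace SClip

noncomputable section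

/-- `ℝ^d` with the Euclidean norm. -/
abbrev Vec (d : ℕ) : Type := EuclideanSpace ℝ (Fin d)

/-- The scalar smooth clipping operator `Ψ(y) = y φ / √(y² + ε)`. -/
def clip (φ ε y : ℝ) : ℝ := y * φ / √(y ^ 2 + ε)

/-- The component-wise smooth clipping operator. -/
def clipVec {d : ℕ} (φ ε : ℝ) (y : Vec d) : Vec d :=
  WithLp.toLp 2 (fun k => clip φ ε (y k))

/-- The state of the network: the models `x i` and the gradient estimators `m i`. -/
structure State (n d : ℕ) where
  x : Fin n → Vec d
  m : Fin n → Vec d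

/-- The algorithm SClip-EF-Network run along one realization `ξ` of the gradient noise: node `i`
observes `∇ f_i (x_i^t) + ξ_i^t`, every node starts at `x0`, and `m_i^0 = 0`. -/
def run {n d : ℕ} (W : Matrix (Fin n) (Fin n) ℝ) (f : Fin n → Vec d → ℝ)
    (φ ε β η : ℕ → ℝ) (x0 : Vec d) (ξ : ℕ → Fin n → Vec d) : ℕ → State n d
  | 0 => { x := fun _ => x0, m := fun _ => 0 }
  | t + 1 =>
    let s := run W f φ ε β η x0 ξ t
    let m' : Fin n → Vec d := fun i =>
      β t • s.m i + (1 - β t) • clipVec (φ t) (ε t) (gradient (f i) (s.x i) + ξ t i - s.m i)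
    { x := fun i => ∑ j, W i j • (s.x j - η t • m' j), m := m' }

/-- The parameter `φ_t = c_φ / √(t + 1)`. -/
def phi (cφ : ℝ) (t : ℕ) : ℝ := cφ / √((t : ℝ) + 1)

/-- The parameter `ε_t = τ (t + 1)^{3/5}`. -/
def eps (τ : ℝ) (t : ℕ) : ℝ := τ * ((t : ℝ) + 1) ^ (3 / 5 : ℝ)

/-- The parameter `β_t = c_β / √(t + 1)`. -/
def beta (cβ : ℝ) (t : ℕ) : ℝ := cβ / √((t : ℝ) + 1)

/-- The parameter `η_t = c_η / (t + 1)^{1/5}`. -/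
def eta (cη : ℝ) (t : ℕ) : ℝ := cη / ((t : ℝ) + 1) ^ (1 / 5 : ℝ)

/-- `g` is twice continuously differentiable with `μ I ≼ ∇² g(x) ≼ L I` at every `x`. -/
def HessianBetween {d : ℕ} (μ L : ℝ) (g : Vec d → ℝ) : Prop :=
  ContDiff ℝ 2 g ∧ ∀ x v : Vec d,
    μ * ‖v‖ ^ 2 ≤ fderiv ℝ (fderiv ℝ g) x v v ∧ fderiv ℝ (fderiv ℝ g) x v v ≤ L * ‖v‖ ^ 2

/-- The average objective `f = (1/n) ∑ i, f_i`. -/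
def average {n d : ℕ} (f : Fin n → Vec d → ℝ) (x : Vec d) : ℝ := (1 / (n : ℝ)) * ∑ i, f i x

/-- The gradient noise: the families `(ξ_i^t)_i` are independent over the iterations `t` (no
independence over the nodes or the components is asked), and every component of every `ξ_i^t` has
the same marginal density `p`, which is symmetric about zero with first absolute moment at
most `σ`. -/
structure IsSymmetricNoise {n d : ℕ} {Ω : Type*} [MeasurableSpace Ω] (P : Measure Ω)
    (ξ : ℕ → Fin n → Ω → Vec d) (p : ℝ → ℝ) (σ : ℝ) : Prop where
  measurable_noise : ∀ t i, Measurable (ξ t i)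
  indep : iIndepFun (fun t ω => fun i => ξ t i ω) P
  measurable_density : Measurable p
  density_nonneg : ∀ u, 0 ≤ p u
  density_symm : ∀ u, p (-u) = p u
  marginal : ∀ t i k,
    P.map (fun ω => ξ t i ω k) = volume.withDensity (fun u => ENNReal.ofReal (p u))
  integrable_moment : Integrable (fun u : ℝ => |u| * p u)
  moment_le : ∫ u : ℝ, |u| * p u ≤ σ

/-- `W` is a mixing matrix for the directed graph `G` (an arc `j → i` lets node `j` send to
node `i`): `G` is strongly connected, `W` is nonnegative and doubly stochastic, an off-diagonal
entry is nonzero only along an arc, and `‖W - 1 1ᵀ / n‖₂ < 1`. -/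
structure IsMixing {n : ℕ} (G : Digraph (Fin n)) (W : Matrix (Fin n) (Fin n) ℝ) : Prop where
  strongly_connected : ∀ i j, Relation.ReflTransGen G.Adj i j
  doubly_stochastic : W ∈ doublyStochastic ℝ (Fin n)
  support : ∀ i j, W i j ≠ 0 → G.Adj j i ∨ i = j
  contraction : ‖Matrix.toEuclideanCLM (n := Fin n) (𝕜 := ℝ)
    (W - Matrix.of (fun _ _ => 1 / (n : ℝ)))‖ < 1

end

end SClip

/-!
# Convergence of SClip-EF-Network

The effective step size `η_t φ_t / √ε_t` equals `γ / (t + 1)` with `γ = c_η c_φ / √τ`, so the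
method is a stochastic gradient descent whose rate is governed by `μ γ`, which is of order
`d^{-1/2} κ^{-5/4}`. Two features make this work although the noise has a first moment only.

Clipping bounds everything along every realization: the estimators `m_i` are of order `t^{-1/2}`,
the nodes agree up to order `t^{-7/10}`, and the average model stays within
`(10 / 3) √d c_η c_φ t^{3/10}` of the minimizer, up to lower order. The last bound grows at the rate
of `√ε_t`, so with `98 A ≤ b` the components of the local gradients are eventually at most
`(5 / √98) κ^{-1/4} √ε_t` (`clipping_distortion_le`).

On that range the clipping operator, averaged over the symmetric noise and rescaled to slope one,
is a perturbation of the identity: its difference quotients differ from `1` by a fraction of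
`κ^{-1/2}` plus a term `O(σ / √ε_t)` that needs the first moment only (`abs_meanClip_sub_sub_le`).
A diagonal preconditioner that close to the identity preserves the strong monotonicity of a gradient
with Hessian between `μ` and `L`, by the Cauchy-Schwarz inequality for the Hessian form
(`HessianBetween.le_sum_mul_gradient_sub`). The local gradients do not vanish at the minimizer,
but they are bounded there and sum to zero, so they leave a bias of order `t^{-3/10}` only
(`le_sum_mul_average_meanClip`).

Independence over the iterations allows the present noise to be integrated out first
(`integral_norm_sub_smul_sq_le`). The mean squared error `V_t` of the average model then satisfies
`V_{t+1} ≤ (1 - μ γ / (10 (t + 1))) V_t + C (t + 1)^{-7/5}` for large `t` (`exists_recursion`),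
which gives every rate below `min (μ γ / 10) (2 / 5)` (`tendsto_of_recursion`).
-/

namespace SClip

noncomputable section

/-! ### The clipping operator and its average over symmetric noise -/

lemma measurable_clip (φ ε : ℝ) : Measurable (clip φ ε) := by
  unfold clip
  fun_prop

lemma abs_clip_le {φ ε : ℝ} (hφ : 0 ≤ φ) (hε : 0 < ε) (y : ℝ) : |clip φ ε y| ≤ φ := by
  unfold clip
  have h : |y| ≤ √(y ^ 2 + ε) := Real.abs_le_sqrt (by linarith)
  rw [abs_div, abs_mul, abs_of_nonneg hφ, abs_of_nonneg (Real.sqrt_nonneg _),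
    div_le_iff₀ (by positivity), mul_comm]
  gcongr

lemma clip_neg (φ ε y : ℝ) : clip φ ε (-y) = -clip φ ε y := by
  simp [clip, neg_div]

lemma clip_eq_mul_clip_sqrt {φ ε : ℝ} (hε : 0 < ε) (y : ℝ) :
    clip φ ε y = φ / √ε * clip (√ε) ε y := by
  have : √ε ≠ 0 := by positivity
  unfold clip
  field_simp

lemma hasDerivAt_clip_sqrt {ε : ℝ} (hε : 0 < ε) (y : ℝ) :
    HasDerivAt (clip (√ε) ε) ((√ε / √(y ^ 2 + ε)) ^ 3) y := by
  have hpos : 0 < y ^ 2 + ε := by positivity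
  have hs : √(y ^ 2 + ε) ≠ 0 := by positivity
  have h1 : HasDerivAt (fun y : ℝ => y ^ 2 + ε) (2 * y) y := by
    simpa using (hasDerivAt_pow 2 y).add_const ε
  have h2 := ((hasDerivAt_id y).mul_const (√ε)).div (h1.sqrt hpos.ne') hs
  refine h2.congr_deriv ?_
  have e1 : √(y ^ 2 + ε) ^ 2 = y ^ 2 + ε := Real.sq_sqrt hpos.le
  have e2 : √ε ^ 2 = ε := Real.sq_sqrt hε.le
  simp only [id]
  rw [div_pow]
  field_simp
  linear_combination e1 - e2

lemma clip_sqrt_deriv_bounds {ε : ℝ} (hε : 0 < ε) (y : ℝ) :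
    0 ≤ (√ε / √(y ^ 2 + ε)) ^ 3 ∧ (√ε / √(y ^ 2 + ε)) ^ 3 ≤ 1 ∧
      1 - (√ε / √(y ^ 2 + ε)) ^ 3 ≤ 3 / 2 * (y ^ 2 / ε) := by
  have hpos : 0 < y ^ 2 + ε := by positivity
  set k := √ε / √(y ^ 2 + ε) with hk
  have hk0 : 0 < k := by positivity
  have hk1 : k ≤ 1 := by
    rw [hk, div_le_one (by positivity)]
    exact Real.sqrt_le_sqrt (by nlinarith [sq_nonneg y])
  have hk2 : k ^ 2 = ε / (y ^ 2 + ε) := by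
    rw [hk, div_pow, Real.sq_sqrt hε.le, Real.sq_sqrt hpos.le]
  have hy : y ^ 2 / ε = 1 / k ^ 2 - 1 := by
    rw [hk2]
    field_simp
    ring
  refine ⟨by positivity, pow_le_one₀ hk0.le hk1, ?_⟩
  -- `3 - 5k² + 2k⁵ = (k - 1)² (2k³ + 4k² + 6k + 3)`
  have hfac : 3 / 2 * (1 / k ^ 2 - 1) - (1 - k ^ 3)
      = (k - 1) ^ 2 * (2 * k ^ 3 + 4 * k ^ 2 + 6 * k + 3) / (2 * k ^ 2) := by
    field_simp
    ring
  have : 0 ≤ (k - 1) ^ 2 * (2 * k ^ 3 + 4 * k ^ 2 + 6 * k + 3) / (2 * k ^ 2) := by positivity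
  rw [hy]
  linarith

lemma abs_clip_sqrt_sub_le {ε : ℝ} (hε : 0 < ε) (a b : ℝ) :
    |clip (√ε) ε a - clip (√ε) ε b| ≤ |a - b| := by
  have h := Convex.norm_image_sub_le_of_norm_hasDerivWithin_le (C := 1) (s := Set.univ)
    (fun y _ => (hasDerivAt_clip_sqrt hε y).hasDerivWithinAt)
    (fun y _ => by
      obtain ⟨h0, h1, -⟩ := clip_sqrt_deriv_bounds hε y
      rw [Real.norm_of_nonneg h0]
      exact h1) convex_univ (Set.mem_univ b) (Set.mem_univ a)
  simpa using h

/-- The clipping operator with unit slope at `0` is close to the identity, in the Lipschitz sense,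
on the arguments perturbed by `u`; the dependence on `u` is linear, so that a first moment
suffices to average it. -/
lemma abs_clip_sqrt_sub_sub_le {ε r : ℝ} (hε : 0 < ε) {a b : ℝ} (ha : |a| ≤ r) (hb : |b| ≤ r)
    (u : ℝ) :
    |(a - b) - (clip (√ε) ε (a + u) - clip (√ε) ε (b + u))|
      ≤ (3 * (r ^ 2 / ε) + 2 * (|u| / √ε)) * |a - b| := by
  have hd : ∀ v : ℝ, HasDerivAt (fun v => v - clip (√ε) ε (v + u))
      (1 - (√ε / √((v + u) ^ 2 + ε)) ^ 3) v := fun v => by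
    have := (hasDerivAt_clip_sqrt hε (v + u)).comp_add_const v u
    exact (hasDerivAt_id v).sub this
  have hbound : ∀ v ∈ Set.Icc (-r) r,
      ‖1 - (√ε / √((v + u) ^ 2 + ε)) ^ 3‖ ≤ 3 * (r ^ 2 / ε) + 2 * (|u| / √ε) := by
    intro v hv
    obtain ⟨h0, h1, h2⟩ := clip_sqrt_deriv_bounds hε (v + u)
    rw [Real.norm_of_nonneg (by linarith)]
    have hv2 : v ^ 2 ≤ r ^ 2 := sq_le_sq' hv.1 hv.2
    set w := |u| / √ε with hw
    have hw0 : 0 ≤ w := by positivity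
    have hw2 : w ^ 2 = u ^ 2 / ε := by rw [hw, div_pow, sq_abs, Real.sq_sqrt hε.le]
    have h3 : (v + u) ^ 2 / ε ≤ 2 * (r ^ 2 / ε) + 2 * w ^ 2 := by
      rw [hw2]
      have : (v + u) ^ 2 ≤ 2 * r ^ 2 + 2 * u ^ 2 := by nlinarith [sq_nonneg (v - u)]
      calc (v + u) ^ 2 / ε ≤ (2 * r ^ 2 + 2 * u ^ 2) / ε := by gcongr
        _ = _ := by ring
    have hr0 : 0 ≤ r ^ 2 / ε := by positivity
    by_cases hc : w ≤ 2 / 3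
    · nlinarith
    · nlinarith
  have h := Convex.norm_image_sub_le_of_norm_hasDerivWithin_le (s := Set.Icc (-r) r)
    (fun v _ => (hd v).hasDerivWithinAt) hbound (convex_Icc _ _)
    (abs_le.mp hb : b ∈ Set.Icc (-r) r) (abs_le.mp ha : a ∈ Set.Icc (-r) r)
  simp only [Real.norm_eq_abs] at h
  convert h using 2
  ring

/-- The clipping operator of unit slope at `0`, averaged over additive noise of law `ν`. -/
def meanClip (ν : Measure ℝ) (ε a : ℝ) : ℝ := ∫ u, clip (√ε) ε (a + u) ∂ν

lemma integrable_clip_add {ν : Measure ℝ} [IsProbabilityMeasure ν] {φ ε : ℝ} (hφ : 0 ≤ φ)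
    (hε : 0 < ε) (a : ℝ) : Integrable (fun u => clip φ ε (a + u)) ν :=
  Integrable.of_bound ((measurable_clip φ ε).comp (measurable_const_add a)).aestronglyMeasurable φ
    (ae_of_all _ fun _ => abs_clip_le hφ hε _)

lemma measurable_meanClip (ν : Measure ℝ) [IsProbabilityMeasure ν] (ε : ℝ) :
    Measurable (meanClip ν ε) := by
  have : Measurable (fun q : ℝ × ℝ => clip (√ε) ε (q.1 + q.2)) :=
    (measurable_clip _ _).comp (measurable_fst.add measurable_snd)
  exact this.stronglyMeasurable.integral_prod_right.measurable

lemma abs_meanClip_sub_le {ν : Measure ℝ} [IsProbabilityMeasure ν] {ε : ℝ} (hε : 0 < ε)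
    (a b : ℝ) : |meanClip ν ε a - meanClip ν ε b| ≤ |a - b| := by
  unfold meanClip
  rw [← integral_sub (integrable_clip_add (Real.sqrt_nonneg _) hε a)
    (integrable_clip_add (Real.sqrt_nonneg _) hε b)]
  have h : ∀ u, ‖clip (√ε) ε (a + u) - clip (√ε) ε (b + u)‖ ≤ |a - b| := fun u => by
    simpa only [Real.norm_eq_abs, add_sub_add_right_eq_sub] using
      abs_clip_sqrt_sub_le hε (a + u) (b + u)
  simpa using norm_integral_le_of_norm_le_const (μ := ν) (ae_of_all _ h)

/-- Symmetric noise does not bias the clipping operator at `0`. -/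
lemma meanClip_zero {ν : Measure ℝ} (hsymm : ν.map (fun u => -u) = ν) (ε : ℝ) :
    meanClip ν ε 0 = 0 := by
  have h : meanClip ν ε 0 = -meanClip ν ε 0 := by
    unfold meanClip
    conv_lhs => rw [← hsymm]
    have hm : Measurable fun u => clip (√ε) ε (0 + u) :=
      (measurable_clip _ _).comp (measurable_const_add 0)
    rw [integral_map measurable_neg.aemeasurable hm.aestronglyMeasurable, ← integral_neg]
    simp [clip_neg]
  linarith

lemma abs_meanClip_sub_sub_le {ν : Measure ℝ} [IsProbabilityMeasure ν] {σ ε r : ℝ} (hε : 0 < ε)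
    (hint : Integrable (fun u : ℝ => |u|) ν) (hmom : ∫ u : ℝ, |u| ∂ν ≤ σ)
    {a b : ℝ} (ha : |a| ≤ r) (hb : |b| ≤ r) :
    |(a - b) - (meanClip ν ε a - meanClip ν ε b)|
      ≤ (3 * (r ^ 2 / ε) + 2 * (σ / √ε)) * |a - b| := by
  have ia := integrable_clip_add (ν := ν) (Real.sqrt_nonneg ε) hε a
  have ib := integrable_clip_add (ν := ν) (Real.sqrt_nonneg ε) hε b
  have e1 : (a - b) - (meanClip ν ε a - meanClip ν ε b)
      = ∫ u, ((a - b) - (clip (√ε) ε (a + u) - clip (√ε) ε (b + u))) ∂ν := by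
    have h1 := integral_sub (integrable_const (μ := ν) (a - b)) (ia.sub ib)
    have h2 := integral_sub ia ib
    simp only [Pi.sub_apply] at h1
    rw [h1, h2]
    simp [meanClip]
  have ig : Integrable (fun u => (3 * (r ^ 2 / ε) + 2 * (|u| / √ε)) * |a - b|) ν :=
    ((integrable_const _).add ((hint.div_const _).const_mul _)).mul_const _
  rw [e1]
  have hle : ∀ u, ‖(a - b) - (clip (√ε) ε (a + u) - clip (√ε) ε (b + u))‖
      ≤ (3 * (r ^ 2 / ε) + 2 * (|u| / √ε)) * |a - b| :=
    abs_clip_sqrt_sub_sub_le hε ha hb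
  refine (norm_integral_le_of_norm_le ig (ae_of_all _ hle)).trans ?_
  rw [integral_mul_const, integral_add (integrable_const _) ((hint.div_const _).const_mul _)]
  simp only [integral_const, probReal_univ, smul_eq_mul, one_mul, integral_const_mul,
    integral_div]
  gcongr

/-! ### Gradients of strongly convex functions under diagonal perturbations -/

section Hessian

variable {d : ℕ} {μ L : ℝ} {g : Vec d → ℝ}

/-- The mean value theorem for one coefficient of the gradient. It produces the Hessian at a single
point, which is a symmetric bilinear form. -/
lemma exists_inner_gradient_sub (hg : ContDiff ℝ 2 g) (x y w : Vec d) :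
    ∃ z, inner ℝ (gradient g x - gradient g y) w = fderiv ℝ (fderiv ℝ g) z (x - y) w := by
  have hdiff : Differentiable ℝ (fderiv ℝ g) :=
    (hg.fderiv_right (m := 1) (by norm_num)).differentiable (by norm_num)
  have hline : ∀ s : ℝ, HasDerivAt (fun s : ℝ => y + s • (x - y)) (x - y) s := fun s => by
    simpa using ((hasDerivAt_id s).smul_const (x - y)).const_add y
  have hd : ∀ s : ℝ, HasDerivAt (fun s : ℝ => fderiv ℝ g (y + s • (x - y)) w)
      (fderiv ℝ (fderiv ℝ g) (y + s • (x - y)) (x - y) w) s := fun s => by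
    have h1 := (hdiff (y + s • (x - y))).hasFDerivAt.comp_hasDerivAt s (hline s)
    simpa using h1.clm_apply (hasDerivAt_const s w)
  obtain ⟨s, -, hs⟩ := exists_hasDerivAt_eq_slope _ _ (zero_lt_one' ℝ)
    (fun s _ => (hd s).continuousAt.continuousWithinAt) (fun s _ => hd s)
  refine ⟨y + s • (x - y), ?_⟩
  rw [hs, inner_sub_left, inner_gradient_left, inner_gradient_left]
  simp

lemma HessianBetween.sq_le (hg : HessianBetween μ L g) (hμ : 0 < μ) (z v w : Vec d) :
    (fderiv ℝ (fderiv ℝ g) z v w) ^ 2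
      ≤ fderiv ℝ (fderiv ℝ g) z v v * fderiv ℝ (fderiv ℝ g) z w w := by
  let B : LinearMap.BilinForm ℝ (Vec d) :=
    LinearMap.mk₂ ℝ (fun v w => fderiv ℝ (fderiv ℝ g) z v w) (by simp) (by simp) (by simp)
      (by simp)
  have hpos : ∀ v, 0 ≤ B v v := fun v =>
    le_trans (by positivity) (hg.2 z v).1
  have hsymm : LinearMap.IsSymm B := ⟨fun v w => by
    have : IsSymmSndFDerivAt ℝ g z :=
      hg.1.contDiffAt.isSymmSndFDerivAt (by simp [minSmoothness_of_isRCLikeNormedField])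
    exact this v w⟩
  exact B.apply_sq_le_of_symm hpos hsymm v w

lemma HessianBetween.norm_gradient_sub_le (hg : HessianBetween μ L g) (hμ : 0 < μ) (hL : μ ≤ L)
    (x y : Vec d) : ‖gradient g x - gradient g y‖ ≤ L * ‖x - y‖ := by
  set w := gradient g x - gradient g y with hw
  obtain ⟨z, hz⟩ := exists_inner_gradient_sub hg.1 x y w
  rw [← hw, real_inner_self_eq_norm_sq] at hz
  have h1 := hg.sq_le hμ z (x - y) w
  have h2 := (hg.2 z (x - y)).2
  have h3 := (hg.2 z w).2
  have h4 : 0 ≤ fderiv ℝ (fderiv ℝ g) z w w := le_trans (by positivity) (hg.2 z w).1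
  have hL0 : 0 < L := hμ.trans_le hL
  have h5 : (‖w‖ ^ 2) ^ 2 ≤ (L * ‖x - y‖ * ‖w‖) ^ 2 := by
    rw [hz]
    calc _ ≤ _ := h1
      _ ≤ (L * ‖x - y‖ ^ 2) * (L * ‖w‖ ^ 2) := by gcongr
      _ = _ := by ring
  have h6 : ‖w‖ ^ 2 ≤ L * ‖x - y‖ * ‖w‖ := le_of_sq_le_sq h5 (by positivity)
  rcases (norm_nonneg w).eq_or_lt with h0 | h0
  · rw [← h0]; positivity
  · exact le_of_mul_le_mul_right (by linarith [sq ‖w‖]) h0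

/-- Strong monotonicity of the gradient survives a diagonal preconditioner `D` which is close to the
identity within a fraction of `κ^{-1/2}`: in the form `H` of the Hessian at the point given by the
mean value theorem, `H(e, (1 - D) e)² ≤ H(e, e) H((1 - D) e, (1 - D) e)`, and the last
factor is at most `θ² κ H(e, e)`. -/
lemma HessianBetween.le_sum_mul_gradient_sub (hg : HessianBetween μ L g) (hμ : 0 < μ) (hL : μ ≤ L)
    {D : Fin d → ℝ} {θ ρ : ℝ} (hD : ∀ k, |1 - D k| ≤ θ) (hθ0 : 0 ≤ θ)
    (hθ : θ * √(L / μ) ≤ ρ) (hρ : ρ ≤ 1) (x y : Vec d) :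
    μ * (1 - ρ) * ‖x - y‖ ^ 2 ≤
      ∑ k, (x - y) k * (D k * (gradient g x - gradient g y) k) := by
  set e := x - y with he
  set v : Vec d := WithLp.toLp 2 (fun k => (1 - D k) * e k) with hv
  obtain ⟨z, hz⟩ := exists_inner_gradient_sub hg.1 x y (e - v)
  have hsum : ∑ k, e k * (D k * (gradient g x - gradient g y) k)
      = fderiv ℝ (fderiv ℝ g) z e e - fderiv ℝ (fderiv ℝ g) z e v := by
    rw [← map_sub, he, ← hz, PiLp.inner_apply]
    refine Finset.sum_congr rfl fun k _ => ?_
    simp [hv, he]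
    ring
  have hLpos : 0 < L := hμ.trans_le hL
  set q := fderiv ℝ (fderiv ℝ g) z e e with hq
  have hq1 : μ * ‖e‖ ^ 2 ≤ q := (hg.2 z e).1
  have hq0 : 0 ≤ q := le_trans (by positivity) hq1
  have hvn : ‖v‖ ^ 2 ≤ θ ^ 2 * ‖e‖ ^ 2 := by
    rw [EuclideanSpace.norm_sq_eq, EuclideanSpace.norm_sq_eq, Finset.mul_sum]
    refine Finset.sum_le_sum fun k _ => ?_
    simp only [hv, norm_mul, mul_pow, Real.norm_eq_abs]
    gcongr
    exact hD k
  have hρ0 : 0 ≤ ρ := le_trans (by positivity) hθ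
  have hcs : (fderiv ℝ (fderiv ℝ g) z e v) ^ 2 ≤ (ρ * q) ^ 2 := by
    have h1 := hg.sq_le hμ z e v
    have h2 : fderiv ℝ (fderiv ℝ g) z v v ≤ ρ ^ 2 * q := by
      calc _ ≤ L * ‖v‖ ^ 2 := (hg.2 z v).2
        _ ≤ L * (θ ^ 2 * ‖e‖ ^ 2) := by gcongr
        _ = (θ * √(L / μ)) ^ 2 * (μ * ‖e‖ ^ 2) := by
          rw [mul_pow, Real.sq_sqrt (by positivity)]
          field_simp
        _ ≤ ρ ^ 2 * q := by gcongr
    calc _ ≤ _ := h1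
      _ ≤ q * (ρ ^ 2 * q) := by gcongr
      _ = _ := by ring
  have h3 : fderiv ℝ (fderiv ℝ g) z e v ≤ ρ * q := le_of_sq_le_sq hcs (by positivity)
  rw [hsum]
  have h4 : (1 - ρ) * (μ * ‖e‖ ^ 2) ≤ (1 - ρ) * q :=
    mul_le_mul_of_nonneg_left hq1 (by linarith)
  linarith

lemma HessianBetween.measurable_gradient (hg : HessianBetween μ L g) :
    Measurable (gradient g) := by
  have h : Continuous (fderiv ℝ g) := hg.1.continuous_fderiv (by norm_num)
  exact ((InnerProductSpace.toDual ℝ (Vec d)).symm.continuous.comp h).measurable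

end Hessian

lemma sum_gradient_eq_zero {n d : ℕ} {f : Fin n → Vec d → ℝ} (hf : ∀ i, Differentiable ℝ (f i))
    {xstar : Vec d} (hmin : IsMinOn (average f) Set.univ xstar) :
    ∑ i, gradient (f i) xstar = 0 := by
  rcases Nat.eq_zero_or_pos n with rfl | hn
  · simp
  have h1 : fderiv ℝ (average f) xstar = 0 :=
    (hmin.isLocalMin Filter.univ_mem).fderiv_eq_zero
  have h2 : fderiv ℝ (average f) xstar = (1 / (n : ℝ)) • ∑ i, fderiv ℝ (f i) xstar := by
    have : HasFDerivAt (average f) ((1 / (n : ℝ)) • ∑ i, fderiv ℝ (f i) xstar) xstar :=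
      (HasFDerivAt.fun_sum fun i _ => (hf i xstar).hasFDerivAt).const_mul _
    exact this.fderiv
  have hn' : (1 / (n : ℝ)) ≠ 0 := by positivity
  have h3 : ∑ i, fderiv ℝ (f i) xstar = 0 := by
    rw [h1] at h2
    exact (smul_eq_zero.mp h2.symm).resolve_left hn'
  unfold gradient
  rw [← map_sum, h3, map_zero]

/-- The averaged clipped gradients, at arguments `y i` within `ζ` of the local gradients at `x`,
still point away from the minimizer. The local gradients at the minimizer need not vanish; only
their sum does, and clipping distorts each of them by at most `c (3 c² / ε + 2 σ / √ε)`. -/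
lemma le_sum_mul_average_meanClip {n d : ℕ} (hn : 0 < n) {f : Fin n → Vec d → ℝ} {μ L : ℝ}
    (hμ : 0 < μ) (hL : μ ≤ L) (hf : ∀ i, HessianBetween μ L (f i)) {xstar : Vec d}
    (hmin : IsMinOn (average f) Set.univ xstar) {ν : Measure ℝ} [IsProbabilityMeasure ν]
    (hsymm : ν.map (fun u => -u) = ν) (hint : Integrable (fun u : ℝ => |u|) ν) {σ : ℝ}
    (hmom : ∫ u : ℝ, |u| ∂ν ≤ σ) {ε r c ζ ρ : ℝ} (hε : 0 < ε) (hc0 : 0 ≤ c) (hcr : c ≤ r)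
    (hρ : ρ ≤ 1) (hθ : (3 * (r ^ 2 / ε) + 2 * (σ / √ε)) * √(L / μ) ≤ ρ)
    (hc : ∀ i k, |gradient (f i) xstar k| ≤ c) {x : Vec d} (hx : ∀ i k, |gradient (f i) x k| ≤ r)
    {y : Fin n → Fin d → ℝ} (hy : ∀ i k, |y i k - gradient (f i) x k| ≤ ζ) :
    μ * (1 - ρ) * ‖x - xstar‖ ^ 2
        - d * (ζ + (3 * (c ^ 2 / ε) + 2 * (σ / √ε)) * c) * ‖x - xstar‖
      ≤ ∑ k, (x - xstar) k * ((1 / (n : ℝ)) * ∑ i, meanClip ν ε (y i k)) := by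
  set e := x - xstar with he
  have hσ : 0 ≤ σ := le_trans (integral_nonneg fun u => abs_nonneg u) hmom
  set b := (3 * (c ^ 2 / ε) + 2 * (σ / √ε)) * c with hb
  have hek : ∀ k, |e k| ≤ ‖e‖ := fun k => PiLp.norm_apply_le e k
  have hnode : ∀ i, μ * (1 - ρ) * ‖e‖ ^ 2 - d * (ζ + b) * ‖e‖ + ∑ k, e k * gradient (f i) xstar k
      ≤ ∑ k, e k * meanClip ν ε (y i k) := by
    intro i
    set g := gradient (f i) x with hg
    set gs := gradient (f i) xstar with hgs
    -- the slopes of the averaged operator between the two gradients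
    set D : Fin d → ℝ := fun k =>
      if g k = gs k then 1 else (meanClip ν ε (g k) - meanClip ν ε (gs k)) / (g k - gs k) with hD
    have hDmul : ∀ k, D k * (g k - gs k) = meanClip ν ε (g k) - meanClip ν ε (gs k) := by
      intro k
      by_cases h : g k = gs k
      · simp [h]
      · have : g k - gs k ≠ 0 := sub_ne_zero.mpr h
        simp only [hD, h, if_false]
        field_simp
    have hDle : ∀ k, |1 - D k| ≤ 3 * (r ^ 2 / ε) + 2 * (σ / √ε) := by
      intro k
      by_cases h : g k = gs k
      · simp only [hD, h, if_true, sub_self, abs_zero]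
        positivity
      · have hne : 0 < |g k - gs k| := abs_pos.mpr (sub_ne_zero.mpr h)
        have h1 := abs_meanClip_sub_sub_le hε hint hmom (hx i k) ((hc i k).trans hcr)
        rw [← hDmul k, ← one_sub_mul, abs_mul] at h1
        exact le_of_mul_le_mul_right h1 hne
    have hmain := (hf i).le_sum_mul_gradient_sub hμ hL hDle (by positivity) hθ hρ x xstar
    have hterm : ∀ k, e k * (D k * (g - gs) k) + e k * gs k - (ζ + b) * ‖e‖
        ≤ e k * meanClip ν ε (y i k) := by
      intro k
      have h1 : |meanClip ν ε (y i k) - meanClip ν ε (g k)| ≤ ζ :=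
        (abs_meanClip_sub_le hε _ _).trans (hy i k)
      have h2 : |gs k - meanClip ν ε (gs k)| ≤ b := by
        have h3 := abs_meanClip_sub_sub_le (r := c) hε hint hmom (hc i k)
          (by simpa using hc0 : |(0 : ℝ)| ≤ c)
        rw [meanClip_zero hsymm, sub_zero, sub_zero] at h3
        exact h3.trans (by rw [hb]; gcongr; exact hc i k)
      have h4 : |e k * ((meanClip ν ε (y i k) - meanClip ν ε (g k))
          - (gs k - meanClip ν ε (gs k)))| ≤ ‖e‖ * (ζ + b) := by
        rw [abs_mul]
        gcongr
        · exact hek k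
        · exact (abs_sub _ _).trans (add_le_add h1 h2)
      have h5 := (abs_le.mp h4).1
      simp only [PiLp.sub_apply, hDmul]
      linarith
    have hsum := Finset.sum_le_sum fun k (_ : k ∈ Finset.univ) => hterm k
    rw [Finset.sum_sub_distrib, Finset.sum_add_distrib] at hsum
    simp only [Finset.sum_const, Finset.card_univ, Fintype.card_fin, nsmul_eq_mul] at hsum
    linarith
  have hzero : ∑ i, ∑ k, e k * gradient (f i) xstar k = 0 := by
    have h0 := sum_gradient_eq_zero (fun i => (hf i).1.differentiable (by norm_num)) hmin
    rw [Finset.sum_comm]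
    refine Finset.sum_eq_zero fun k _ => ?_
    rw [← Finset.mul_sum]
    have : (∑ i, gradient (f i) xstar) k = 0 := by rw [h0]; rfl
    rw [WithLp.ofLp_sum, Finset.sum_apply] at this
    rw [this, mul_zero]
  have hsum := Finset.sum_le_sum fun i (_ : i ∈ Finset.univ) => hnode i
  rw [Finset.sum_add_distrib, hzero, Finset.sum_comm] at hsum
  simp only [Finset.sum_const, Finset.card_univ, Fintype.card_fin, nsmul_eq_mul, add_zero,
    ← Finset.mul_sum] at hsum
  have hn' : (0 : ℝ) < n := by exact_mod_cast hn
  have hrw : ∑ k, e k * ((1 / (n : ℝ)) * ∑ i, meanClip ν ε (y i k))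
      = (∑ k, e k * ∑ i, meanClip ν ε (y i k)) / n := by
    rw [Finset.sum_div]
    refine Finset.sum_congr rfl fun k _ => ?_
    ring
  rw [hrw, le_div_iff₀ hn']
  linarith

/-! ### Real sequences driven by powers of the time -/

/-- A geometrically contracted sequence decays like its inhomogeneity. The bound depends
on the data only, not on the sequence. The comparison sequence `(t + N)^{-s}` with `N` large is
slow enough to absorb the factor `ρ` from the first step on. -/
lemma exists_le_mul_rpow_of_contraction {ρ C A s : ℝ} (hρ0 : 0 ≤ ρ) (hρ : ρ < 1) (hC : 0 ≤ C)
    (hA : 0 ≤ A) (hs0 : 0 ≤ s) (hs1 : s ≤ 1) :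
    ∃ K, 0 ≤ K ∧ ∀ a : ℕ → ℝ, a 0 ≤ A →
      (∀ t, a (t + 1) ≤ ρ * a t + C * ((t : ℝ) + 1) ^ (-s)) →
      ∀ t, a t ≤ K * ((t : ℝ) + 1) ^ (-s) := by
  obtain ⟨N, hN⟩ := exists_nat_ge (2 / (1 - ρ))
  have h1ρ : 0 < 1 - ρ := by linarith
  have hN1 : (1 : ℝ) ≤ N := by
    refine le_trans ?_ hN
    rw [le_div_iff₀ h1ρ]
    linarith
  have hNρ : 2 ≤ N * (1 - ρ) := by rwa [div_le_iff₀ h1ρ] at hN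
  set K := A * (N : ℝ) ^ s + 2 * (N + 1) * (C * (N : ℝ) ^ s) with hK
  have hNs : (0 : ℝ) < (N : ℝ) ^ s := by positivity
  have hK0 : 0 ≤ K := by positivity
  refine ⟨K, hK0, fun a ha0 ha t => ?_⟩
  have key : ∀ t : ℕ, a t ≤ K * ((t : ℝ) + N) ^ (-s) := by
    intro t
    induction t with
    | zero =>
      have : A ≤ K * (N : ℝ) ^ (-s) := by
        rw [Real.rpow_neg (by positivity), ← div_eq_mul_inv, le_div_iff₀ hNs, hK]
        have : 0 ≤ 2 * ((N : ℝ) + 1) * (C * (N : ℝ) ^ s) := by positivity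
        linarith
      simpa using ha0.trans this
    | succ t ih =>
      have hp : (0 : ℝ) < (t : ℝ) + N := by positivity
      have h1 : ((t : ℝ) + 1) ^ (-s) ≤ (N : ℝ) ^ s * ((t : ℝ) + N) ^ (-s) := by
        rw [Real.rpow_neg (by positivity), Real.rpow_neg (by positivity), ← div_eq_mul_inv,
          ← one_div, div_le_div_iff₀ (by positivity) (by positivity), one_mul,
          ← Real.mul_rpow (by positivity) (by positivity)]
        apply Real.rpow_le_rpow (by positivity) _ hs0
        nlinarith [(Nat.cast_nonneg t : (0 : ℝ) ≤ t)]
      have h2 : ((t : ℝ) + N) ^ (-s) ≤ (1 + 1 / N) * ((t : ℝ) + 1 + N) ^ (-s) := by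
        rw [Real.rpow_neg (by positivity), Real.rpow_neg (by positivity), ← div_eq_mul_inv,
          ← one_div, div_le_div_iff₀ (by positivity) (by positivity), one_mul]
        have h3 : (1 + 1 / ((t : ℝ) + N)) ^ s ≤ 1 + s * (1 / ((t : ℝ) + N)) :=
          rpow_one_add_le_one_add_mul_self
            (le_trans (by norm_num) (by positivity : (0 : ℝ) ≤ 1 / ((t : ℝ) + N))) hs0 hs1
        have h4 : s * (1 / ((t : ℝ) + N)) ≤ 1 / N := by
          calc s * (1 / ((t : ℝ) + N)) ≤ 1 * (1 / (0 + N)) := by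
                gcongr
                positivity
            _ = 1 / N := by ring
        have h5 : (t : ℝ) + 1 + N = (1 + 1 / ((t : ℝ) + N)) * ((t : ℝ) + N) := by
          field_simp
          ring
        rw [h5, Real.mul_rpow (by positivity) (by positivity)]
        gcongr
        linarith
      have h6 : (ρ * K + C * (N : ℝ) ^ s) * (1 + 1 / N) ≤ K := by
        have hN0 : (0 : ℝ) < N := by linarith
        have h7 : (ρ * K + C * (N : ℝ) ^ s) * (1 + 1 / N)
            = (ρ * K + C * (N : ℝ) ^ s) * (N + 1) / N := by field_simp
        rw [h7, div_le_iff₀ hN0]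
        have h8 : 2 * (N + 1) * (C * (N : ℝ) ^ s) ≤ K := by
          rw [hK]
          have : 0 ≤ A * (N : ℝ) ^ s := by positivity
          linarith
        have h9 : ρ * (N + 1) ≤ N - 1 := by nlinarith
        nlinarith [mul_le_mul_of_nonneg_left h9 hK0]
      push_cast
      calc a (t + 1) ≤ ρ * a t + C * ((t : ℝ) + 1) ^ (-s) := ha t
        _ ≤ ρ * (K * ((t : ℝ) + N) ^ (-s)) + C * ((N : ℝ) ^ s * ((t : ℝ) + N) ^ (-s)) := by gcongr
        _ = (ρ * K + C * (N : ℝ) ^ s) * ((t : ℝ) + N) ^ (-s) := by ring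
        _ ≤ (ρ * K + C * (N : ℝ) ^ s) * ((1 + 1 / N) * ((t : ℝ) + 1 + N) ^ (-s)) := by gcongr
        _ = (ρ * K + C * (N : ℝ) ^ s) * (1 + 1 / N) * ((t : ℝ) + 1 + N) ^ (-s) := by ring
        _ ≤ K * ((t : ℝ) + 1 + N) ^ (-s) := by gcongr
  refine (key t).trans ?_
  gcongr ?_ * ?_
  exact Real.rpow_le_rpow_of_nonpos (by positivity) (by linarith) (by linarith)

/-- A telescoping bound for sums of `(t + 1)^{-7/10}`. -/
lemma rpow_add_le_rpow_succ (t : ℕ) :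
    (t : ℝ) ^ (3 / 10 : ℝ) + 3 / 10 * ((t : ℝ) + 1) ^ (-(7 / 10) : ℝ)
      ≤ ((t : ℝ) + 1) ^ (3 / 10 : ℝ) := by
  have hs : (0 : ℝ) < (t : ℝ) + 1 := by positivity
  have h1 : (t : ℝ) = (1 + -(1 / ((t : ℝ) + 1))) * ((t : ℝ) + 1) := by
    field_simp
    ring
  have h0 : -1 ≤ -(1 / ((t : ℝ) + 1)) := by
    have : 1 / ((t : ℝ) + 1) ≤ 1 := by
      rw [div_le_one hs]
      linarith [(Nat.cast_nonneg t : (0 : ℝ) ≤ t)]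
    linarith
  have h2 : (t : ℝ) ^ (3 / 10 : ℝ)
      ≤ (1 + 3 / 10 * -(1 / ((t : ℝ) + 1))) * ((t : ℝ) + 1) ^ (3 / 10 : ℝ) := by
    conv_lhs => rw [h1]
    rw [Real.mul_rpow (by linarith) hs.le]
    gcongr
    exact rpow_one_add_le_one_add_mul_self h0 (by norm_num) (by norm_num)
  have h3 : ((t : ℝ) + 1) ^ (-(7 / 10) : ℝ)
      = 1 / ((t : ℝ) + 1) * ((t : ℝ) + 1) ^ (3 / 10 : ℝ) := by
    rw [show (-(7 / 10) : ℝ) = -1 + 3 / 10 by norm_num, Real.rpow_add hs, Real.rpow_neg_one,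
      one_div]
  rw [h3]
  linarith

/-- A sequence whose increments are at most `a (t + 1)^{-7/10} + C (t + 1)^{-6/5}` grows at most
like `(10 / 3) a t^{3/10}`, uniformly. -/
lemma exists_le_of_increment_le {a C : ℝ} (ha : 0 ≤ a) (hC : 0 ≤ C) :
    ∃ B, ∀ u : ℕ → ℝ,
      (∀ t, u (t + 1) ≤ u t + a * ((t : ℝ) + 1) ^ (-(7 / 10) : ℝ)
        + C * ((t : ℝ) + 1) ^ (-(6 / 5) : ℝ)) →
      ∀ t : ℕ, u t ≤ u 0 + B + 10 / 3 * a * ((t : ℝ) + 1) ^ (3 / 10 : ℝ) := by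
  have hsum : Summable fun t : ℕ => ((t : ℝ) + 1) ^ (-(6 / 5) : ℝ) := by
    have := (summable_nat_add_iff 1).mpr
      (Real.summable_nat_rpow.mpr (by norm_num : -(6 / 5) < (-1 : ℝ)))
    simpa using this
  refine ⟨C * ∑' t : ℕ, ((t : ℝ) + 1) ^ (-(6 / 5) : ℝ), fun u hu t => ?_⟩
  have key : ∀ t : ℕ, u t ≤ u 0 + C * ∑ s ∈ Finset.range t, ((s : ℝ) + 1) ^ (-(6 / 5) : ℝ)
      + 10 / 3 * a * (t : ℝ) ^ (3 / 10 : ℝ) := by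
    intro t
    induction t with
    | zero => simp
    | succ t ih =>
      rw [Finset.sum_range_succ]
      push_cast
      have h1 := mul_le_mul_of_nonneg_left (rpow_add_le_rpow_succ t)
        (by positivity : 0 ≤ 10 / 3 * a)
      have h2 := hu t
      linarith
  have h1 : ∑ s ∈ Finset.range t, ((s : ℝ) + 1) ^ (-(6 / 5) : ℝ)
      ≤ ∑' t : ℕ, ((t : ℝ) + 1) ^ (-(6 / 5) : ℝ) :=
    hsum.sum_le_tsum _ fun s _ => by positivity
  have h2 : (t : ℝ) ^ (3 / 10 : ℝ) ≤ ((t : ℝ) + 1) ^ (3 / 10 : ℝ) := by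
    gcongr
    linarith
  refine (key t).trans ?_
  gcongr

/-- The rate of a sequence with contraction factors `1 - c / (t + 1)` and errors
of order `(t + 1)^{-7/5}`. -/
lemma tendsto_of_recursion {V : ℕ → ℝ} {c C δ : ℝ} {T : ℕ} (hV : ∀ t, 0 ≤ V t) (hC : 0 ≤ C)
    (hrec : ∀ t ≥ T, V (t + 1) ≤ (1 - c / ((t : ℝ) + 1)) * V t
      + C * ((t : ℝ) + 1) ^ (-(7 / 5) : ℝ))
    (hδ0 : 0 < δ) (hδ : δ < min c (2 / 5)) :
    Tendsto (fun t : ℕ => ((t : ℝ) + 1) ^ δ * V t) atTop (𝓝 0) := by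
  -- boundedness at a slightly better exponent suffices
  obtain ⟨γ, hγ1, hγ2⟩ := exists_between hδ
  have hγc : γ < c := hγ2.trans_le (min_le_left _ _)
  have hγ5 : γ < 2 / 5 := hγ2.trans_le (min_le_right _ _)
  have hγ0 : 0 < γ := hδ0.trans hγ1
  obtain ⟨N, hN⟩ := exists_nat_ge c
  set U : ℕ → ℝ := fun t => ((t : ℝ) + 1) ^ γ * V t with hU
  have hstep : ∀ t ≥ max T N, U (t + 1) ≤ U t + 2 * C * ((t : ℝ) + 1) ^ (γ - 7 / 5) := by
    intro t ht
    have hs : (0 : ℝ) < (t : ℝ) + 1 := by positivity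
    set s := (t : ℝ) + 1 with hsdef
    have hcs : c / s ≤ 1 := by
      rw [div_le_one hs, hsdef]
      have : (N : ℝ) ≤ t := by exact_mod_cast (le_max_right T N).trans ht
      linarith
    have h1 : (s + 1) ^ γ ≤ (1 + γ * (1 / s)) * s ^ γ := by
      have h5 : s + 1 = (1 + 1 / s) * s := by field_simp
      rw [h5, Real.mul_rpow (by positivity) hs.le]
      gcongr
      exact rpow_one_add_le_one_add_mul_self
        (le_trans (by norm_num) (by positivity : (0 : ℝ) ≤ 1 / s)) hγ0.le (by linarith)
    have hs1 : 1 ≤ s := by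
      rw [hsdef]
      linarith [(Nat.cast_nonneg t : (0 : ℝ) ≤ t)]
    have h1s : 1 / s ≤ 1 := by
      rw [div_le_one hs]
      exact hs1
    have h2 : (1 + γ * (1 / s)) * (1 - c / s) ≤ 1 := by
      have e1 : c / s = c * (1 / s) := by ring
      have e2 : (0 : ℝ) < 1 / s := by positivity
      rw [e1]
      nlinarith [mul_pos e2 e2, mul_pos hγ0 (hγ0.trans hγc),
        mul_pos (mul_pos hγ0 (hγ0.trans hγc)) (mul_pos e2 e2)]
    have h3 : (1 + γ * (1 / s)) ≤ 2 := by
      nlinarith [(by positivity : (0 : ℝ) < 1 / s)]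
    have h0 : 0 ≤ (1 - c / s) * V t + C * s ^ (-(7 / 5) : ℝ) :=
      add_nonneg (mul_nonneg (by linarith) (hV t)) (by positivity)
    have h4 : s ^ γ * s ^ (-(7 / 5) : ℝ) = s ^ (γ - 7 / 5) := by
      rw [← Real.rpow_add hs]
      rfl
    have hsγ : 0 < s ^ γ := by positivity
    have e3 : U (t + 1) = (s + 1) ^ γ * V (t + 1) := by simp [hU, hsdef]
    rw [e3]
    calc (s + 1) ^ γ * V (t + 1)
        ≤ (1 + γ * (1 / s)) * s ^ γ * ((1 - c / s) * V t + C * s ^ (-(7 / 5) : ℝ)) := by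
          gcongr
          · exact hV _
          · exact hrec t ((le_max_left T N).trans ht)
      _ = (1 + γ * (1 / s)) * (1 - c / s) * (s ^ γ * V t)
          + (1 + γ * (1 / s)) * (C * (s ^ γ * s ^ (-(7 / 5) : ℝ))) := by ring
      _ ≤ 1 * (s ^ γ * V t) + 2 * (C * (s ^ γ * s ^ (-(7 / 5) : ℝ))) := by
          gcongr
          exact mul_nonneg hsγ.le (hV t)
      _ = U t + 2 * C * s ^ (γ - 7 / 5) := by
          rw [h4]
          simp only [hU, hsdef]
          ring
  have hsum : Summable fun t : ℕ => ((t : ℝ) + 1) ^ (γ - 7 / 5) := by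
    have := (summable_nat_add_iff 1).mpr
      (Real.summable_nat_rpow.mpr (by linarith : γ - 7 / 5 < (-1 : ℝ)))
    simpa using this
  set M := max T N with hM
  set S := ∑' t : ℕ, ((t : ℝ) + 1) ^ (γ - 7 / 5) with hS
  have hbdd : ∀ t ≥ M, U t ≤ U M + 2 * C * S := by
    have key : ∀ t ≥ M, U t
        ≤ U M + 2 * C * ∑ s ∈ Finset.range t, ((s : ℝ) + 1) ^ (γ - 7 / 5) := by
      intro t ht
      induction t, ht using Nat.le_induction with
      | base =>
        have : 0 ≤ 2 * C * ∑ s ∈ Finset.range M, ((s : ℝ) + 1) ^ (γ - 7 / 5) := by positivity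
        linarith
      | succ t ht ih =>
        rw [Finset.sum_range_succ]
        linarith [hstep t ht]
    intro t ht
    have h1 : ∑ s ∈ Finset.range t, ((s : ℝ) + 1) ^ (γ - 7 / 5) ≤ S :=
      hsum.sum_le_tsum _ fun s _ => by positivity
    refine (key t ht).trans ?_
    gcongr
  have hlim : Tendsto (fun t : ℕ => (U M + 2 * C * S) * ((t : ℝ) + 1) ^ (-(γ - δ))) atTop
      (𝓝 0) := by
    have h1 : Tendsto (fun t : ℕ => (t : ℝ) + 1) atTop atTop :=
      tendsto_atTop_add_const_right _ _ tendsto_natCast_atTop_atTop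
    simpa using ((tendsto_rpow_neg_atTop (by linarith : 0 < γ - δ)).comp h1).const_mul
      (U M + 2 * C * S)
  refine squeeze_zero' (Eventually.of_forall fun t => mul_nonneg (by positivity) (hV t)) ?_ hlim
  filter_upwards [eventually_ge_atTop M] with t ht
  have hs : (0 : ℝ) < (t : ℝ) + 1 := by positivity
  have e : ((t : ℝ) + 1) ^ δ * V t = U t * ((t : ℝ) + 1) ^ (-(γ - δ)) := by
    have : ((t : ℝ) + 1) ^ δ = ((t : ℝ) + 1) ^ γ * ((t : ℝ) + 1) ^ (-(γ - δ)) := by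
      rw [← Real.rpow_add hs]
      congr 1
      ring
    rw [this]
    simp only [hU]
    ring
  rw [e]
  gcongr
  exact hbdd t ht

/-! ### One step of the algorithm along a realization of the noise -/

lemma norm_le_sqrt_mul {d : ℕ} {w : Vec d} {M : ℝ} (hM : 0 ≤ M) (h : ∀ k, |w k| ≤ M) :
    ‖w‖ ≤ √d * M := by
  refine le_of_sq_le_sq ?_ (by positivity)
  rw [EuclideanSpace.norm_sq_eq, mul_pow, Real.sq_sqrt (Nat.cast_nonneg d)]
  calc ∑ k, ‖w k‖ ^ 2 ≤ ∑ _k : Fin d, M ^ 2 := by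
        gcongr with k
        exact h k
    _ = d * M ^ 2 := by simp

/-- The average of the vectors `v i` over the nodes. -/
def nodeMean {n d : ℕ} (v : Fin n → Vec d) : Vec d := (1 / (n : ℝ)) • ∑ i, v i

lemma nodeMean_apply {n d : ℕ} (v : Fin n → Vec d) (k : Fin d) :
    nodeMean v k = (1 / (n : ℝ)) * ∑ i, v i k := by
  simp [nodeMean]

lemma abs_nodeMean_apply_le {n d : ℕ} (hn : 0 < n) {v : Fin n → Vec d} {M : ℝ} {k : Fin d}
    (h : ∀ i, |v i k| ≤ M) : |nodeMean v k| ≤ M := by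
  have hn' : (0 : ℝ) < n := by exact_mod_cast hn
  rw [nodeMean_apply, abs_mul, abs_of_nonneg (by positivity), one_div, inv_mul_le_iff₀ hn']
  calc |∑ i, v i k| ≤ ∑ i, |v i k| := Finset.abs_sum_le_sum_abs _ _
    _ ≤ ∑ _i : Fin n, M := Finset.sum_le_sum fun i _ => h i
    _ = n * M := by simp

section Run

variable {n d : ℕ} (W : Matrix (Fin n) (Fin n) ℝ) (f : Fin n → Vec d → ℝ) (φ ε β η : ℕ → ℝ)
  (x0 : Vec d) (z : ℕ → Fin n → Vec d)

lemma run_succ_m_apply (t : ℕ) (i : Fin n) (k : Fin d) :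
    (run W f φ ε β η x0 z (t + 1)).m i k
      = β t * (run W f φ ε β η x0 z t).m i k
        + (1 - β t) * clip (φ t) (ε t)
          (gradient (f i) ((run W f φ ε β η x0 z t).x i) k - (run W f φ ε β η x0 z t).m i k
            + z t i k) := by
  simp only [run, clipVec, PiLp.add_apply, PiLp.smul_apply, smul_eq_mul, PiLp.sub_apply]
  congr 3
  ring

lemma run_succ_x (t : ℕ) (i : Fin n) :
    (run W f φ ε β η x0 z (t + 1)).x i
      = ∑ j, W i j • ((run W f φ ε β η x0 z t).x j
          - η t • (run W f φ ε β η x0 z (t + 1)).m j) := rfl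

variable {W}

/-- A doubly stochastic mixing matrix leaves the average model to a plain descent step. -/
lemma nodeMean_run_succ (hW : W ∈ doublyStochastic ℝ (Fin n)) (t : ℕ) :
    nodeMean (run W f φ ε β η x0 z (t + 1)).x
      = nodeMean (run W f φ ε β η x0 z t).x
        - η t • nodeMean (run W f φ ε β η x0 z (t + 1)).m := by
  have hcol : ∀ j, ∑ i, W i j = 1 := sum_col_of_mem_doublyStochastic hW
  have h : ∑ i, (run W f φ ε β η x0 z (t + 1)).x i
      = ∑ j, ((run W f φ ε β η x0 z t).x j
          - η t • (run W f φ ε β η x0 z (t + 1)).m j) := by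
    simp only [run_succ_x]
    rw [Finset.sum_comm]
    refine Finset.sum_congr rfl fun j _ => ?_
    rw [← Finset.sum_smul, hcol, one_smul]
  rw [nodeMean, h, Finset.sum_sub_distrib, ← Finset.smul_sum, smul_sub, smul_comm]
  rfl

variable {φ ε β}

lemma abs_run_succ_m_le {t : ℕ} (hφ : 0 ≤ φ t) (hε : 0 < ε t) (hβ0 : 0 ≤ β t) (hβ1 : β t ≤ 1)
    (i : Fin n) (k : Fin d) :
    |(run W f φ ε β η x0 z (t + 1)).m i k|
      ≤ β t * |(run W f φ ε β η x0 z t).m i k| + φ t := by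
  rw [run_succ_m_apply]
  refine (abs_add_le _ _).trans ?_
  rw [abs_mul, abs_mul, abs_of_nonneg hβ0, abs_of_nonneg (by linarith : 0 ≤ 1 - β t)]
  gcongr
  calc _ ≤ 1 * φ t := by
        gcongr
        · linarith
        · exact abs_clip_le hφ hε _
    _ = φ t := one_mul _

/-- One step of the disagreement between the nodes in one component: it is a step of the
matrix `W - 1 1ᵀ / n`. -/
lemma norm_disagreement_succ_le (hn : 0 < n) (hW : W ∈ doublyStochastic ℝ (Fin n)) {t : ℕ}
    (hη : 0 ≤ η t) {M : ℝ} (hM : 0 ≤ M) {k : Fin d}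
    (hm : ∀ i, |(run W f φ ε β η x0 z (t + 1)).m i k| ≤ M) :
    ‖(WithLp.toLp 2 fun i => (run W f φ ε β η x0 z (t + 1)).x i k
        - nodeMean (run W f φ ε β η x0 z (t + 1)).x k : Vec n)‖
      ≤ ‖Matrix.toEuclideanCLM (n := Fin n) (𝕜 := ℝ)
          (W - Matrix.of (fun _ _ => 1 / (n : ℝ)))‖
        * (‖(WithLp.toLp 2 fun i => (run W f φ ε β η x0 z t).x i k
            - nodeMean (run W f φ ε β η x0 z t).x k : Vec n)‖ + η t * (√n * M)) := by
  set s := run W f φ ε β η x0 z t with hs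
  set s' := run W f φ ε β η x0 z (t + 1) with hs'
  set T := Matrix.toEuclideanCLM (n := Fin n) (𝕜 := ℝ) (W - Matrix.of (fun _ _ => 1 / (n : ℝ)))
    with hT
  set v : Vec n := WithLp.toLp 2 fun i => s.x i k - nodeMean s.x k with hv
  set w : Vec n := WithLp.toLp 2 fun i => s'.m i k with hw
  have hn' : (n : ℝ) ≠ 0 := by positivity
  have hrow : ∀ i, ∑ j, W i j = 1 := sum_row_of_mem_doublyStochastic hW
  have hstep : (WithLp.toLp 2 fun i => s'.x i k - nodeMean s'.x k : Vec n) = T (v - η t • w) := by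
    ext i
    have h1 : s'.x i k = ∑ j, W i j * (s.x j k - η t * s'.m j k) := by
      rw [hs', run_succ_x, WithLp.ofLp_sum, Finset.sum_apply]
      simp [hs]
    have h2 : nodeMean s'.x k = ∑ j, 1 / (n : ℝ) * (s.x j k - η t * s'.m j k) := by
      rw [hs', nodeMean_run_succ f φ ε β η x0 z hW t, PiLp.sub_apply, PiLp.smul_apply,
        nodeMean_apply, nodeMean_apply, ← Finset.mul_sum, Finset.sum_sub_distrib,
        ← Finset.mul_sum, smul_eq_mul]
      ring
    have h3 : ∑ j, (W i j - 1 / (n : ℝ)) = 0 := by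
      rw [Finset.sum_sub_distrib, hrow]
      simp [hn']
    have h4 : T (v - η t • w) i
        = ∑ j, (W i j - 1 / (n : ℝ)) * (s.x j k - nodeMean s.x k - η t * s'.m j k) := by
      rw [hT, Matrix.ofLp_toEuclideanCLM]
      simp [Matrix.mulVec, dotProduct, hv, hw]
    rw [h4]
    change s'.x i k - nodeMean s'.x k = _
    rw [h1, h2, ← Finset.sum_sub_distrib]
    calc _ = ∑ j, (W i j - 1 / (n : ℝ)) * (s.x j k - η t * s'.m j k) - 0 * nodeMean s.x k := by
          rw [zero_mul, sub_zero]
          exact Finset.sum_congr rfl fun j _ => by ring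
      _ = _ := by
          rw [← h3, Finset.sum_mul, ← Finset.sum_sub_distrib]
          exact Finset.sum_congr rfl fun j _ => by ring
  rw [hstep]
  refine (T.le_opNorm _).trans ?_
  gcongr
  refine (norm_sub_le _ _).trans ?_
  rw [norm_smul, Real.norm_of_nonneg hη]
  gcongr
  exact norm_le_sqrt_mul hM hm

end Run

/-! ### The parameter sequences -/

section Parameters

variable {cφ τ cβ cη : ℝ}

lemma one_div_sqrt_eq_rpow (t : ℕ) : 1 / √((t : ℝ) + 1) = ((t : ℝ) + 1) ^ (-(1 / 2) : ℝ) := by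
  rw [Real.sqrt_eq_rpow, Real.rpow_neg (by positivity), one_div]

lemma phi_eq (t : ℕ) : phi cφ t = cφ * ((t : ℝ) + 1) ^ (-(1 / 2) : ℝ) := by
  rw [← one_div_sqrt_eq_rpow, phi, mul_one_div]

lemma beta_eq (t : ℕ) : beta cβ t = cβ * ((t : ℝ) + 1) ^ (-(1 / 2) : ℝ) := phi_eq t

lemma eta_eq (t : ℕ) : eta cη t = cη * ((t : ℝ) + 1) ^ (-(1 / 5) : ℝ) := by
  rw [eta, Real.rpow_neg (by positivity), div_eq_mul_inv]

lemma eps_pos (hτ : 0 < τ) (t : ℕ) : 0 < eps τ t := by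
  unfold eps
  positivity

lemma sqrt_eps (hτ : 0 < τ) (t : ℕ) : √(eps τ t) = √τ * ((t : ℝ) + 1) ^ (3 / 10 : ℝ) := by
  rw [eps, Real.sqrt_mul hτ.le, Real.sqrt_eq_rpow (((t : ℝ) + 1) ^ (3 / 5 : ℝ)),
    ← Real.rpow_mul (by positivity)]
  norm_num

lemma beta_nonneg (hβ : 0 ≤ cβ) (t : ℕ) : 0 ≤ beta cβ t := by
  unfold beta
  positivity

lemma rpow_neg_le_one {s : ℝ} (hs : 0 ≤ s) (t : ℕ) : ((t : ℝ) + 1) ^ (-s) ≤ 1 :=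
  Real.rpow_le_one_of_one_le_of_nonpos (by linarith [(Nat.cast_nonneg t : (0 : ℝ) ≤ t)])
    (by linarith)

lemma rpow_neg_le_rpow_neg {r s : ℝ} (h : r ≤ s) (t : ℕ) :
    ((t : ℝ) + 1) ^ (-s) ≤ ((t : ℝ) + 1) ^ (-r) :=
  Real.rpow_le_rpow_of_exponent_le (by linarith [(Nat.cast_nonneg t : (0 : ℝ) ≤ t)])
    (by linarith)

lemma beta_le (hβ : 0 ≤ cβ) (t : ℕ) : beta cβ t ≤ cβ := by
  rw [beta_eq]
  exact mul_le_of_le_one_right hβ (rpow_neg_le_one (by norm_num) t)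

lemma rpow_neg_succ_le {s : ℝ} (hs : 0 ≤ s) (t : ℕ) :
    (((t + 1 : ℕ) : ℝ) + 1) ^ (-s) ≤ ((t : ℝ) + 1) ^ (-s) :=
  Real.rpow_le_rpow_of_nonpos (by positivity) (by push_cast; linarith) (by linarith)

lemma tendsto_rpow_neg {s : ℝ} (hs : 0 < s) :
    Tendsto (fun t : ℕ => ((t : ℝ) + 1) ^ (-s)) atTop (𝓝 0) :=
  (tendsto_rpow_neg_atTop hs).comp
    (tendsto_atTop_add_const_right _ _ tendsto_natCast_atTop_atTop)

end Parameters

/-! ### Bounds on the iterates that hold for every realization of the noise -/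

section Bounds

variable {n d : ℕ} {W : Matrix (Fin n) (Fin n) ℝ} {f : Fin n → Vec d → ℝ}
  {cφ τ cβ cη : ℝ} {x0 : Vec d}

/-- The gradient estimators are of order `t^{-1/2}`. -/
lemma exists_abs_m_le (hφ : 0 < cφ) (hτ : 0 < τ) (hβ0 : 0 ≤ cβ) (hβ1 : cβ < 1) :
    ∃ K, 0 ≤ K ∧ ∀ (z : ℕ → Fin n → Vec d) (t : ℕ) (i : Fin n) (k : Fin d),
      |(run W f (phi cφ) (eps τ) (beta cβ) (eta cη) x0 z t).m i k|
        ≤ K * ((t : ℝ) + 1) ^ (-(1 / 2) : ℝ) := by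
  obtain ⟨K, hK0, hK⟩ := exists_le_mul_rpow_of_contraction (A := 0) (s := 1 / 2) hβ0 hβ1 hφ.le
    le_rfl (by norm_num) (by norm_num)
  refine ⟨K, hK0, fun z t i k => hK (fun t =>
    |(run W f (phi cφ) (eps τ) (beta cβ) (eta cη) x0 z t).m i k|) (by simp [run]) (fun t => ?_) t⟩
  have h := abs_run_succ_m_le (W := W) f (eta cη) x0 z (φ := phi cφ) (ε := eps τ) (β := beta cβ)
    (t := t) (by rw [phi_eq]; positivity) (eps_pos hτ t) (beta_nonneg hβ0 t)
    ((beta_le hβ0 t).trans hβ1.le) i k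
  rw [phi_eq] at h
  refine h.trans ?_
  gcongr
  exact beta_le hβ0 t

/-- The nodes agree up to order `t^{-7/10}`. -/
lemma exists_abs_x_sub_nodeMean_le (hn : 0 < n) {G : Digraph (Fin n)} (hW : IsMixing G W)
    (hφ : 0 < cφ) (hτ : 0 < τ) (hη : 0 < cη) (hβ0 : 0 ≤ cβ) (hβ1 : cβ < 1) :
    ∃ K, 0 ≤ K ∧ ∀ (z : ℕ → Fin n → Vec d) (t : ℕ) (i : Fin n) (k : Fin d),
      |(run W f (phi cφ) (eps τ) (beta cβ) (eta cη) x0 z t).x i k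
          - nodeMean (run W f (phi cφ) (eps τ) (beta cβ) (eta cη) x0 z t).x k|
        ≤ K * ((t : ℝ) + 1) ^ (-(7 / 10) : ℝ) := by
  obtain ⟨M, hM0, hM⟩ := exists_abs_m_le (W := W) (f := f) (cη := cη) (x0 := x0) hφ hτ hβ0 hβ1
  obtain ⟨K, hK0, hK⟩ := exists_le_mul_rpow_of_contraction (A := 0) (s := 7 / 10)
    (C := cη * (√n * M)) (norm_nonneg _) hW.contraction (by positivity) le_rfl (by norm_num)
    (by norm_num)
  refine ⟨K, hK0, fun z t i k => le_trans ?_ (hK (fun t => ‖(WithLp.toLp 2 fun i =>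
    (run W f (phi cφ) (eps τ) (beta cβ) (eta cη) x0 z t).x i k
      - nodeMean (run W f (phi cφ) (eps τ) (beta cβ) (eta cη) x0 z t).x k : Vec n)‖)
    ?_ (fun t => ?_) t)⟩
  · exact PiLp.norm_apply_le (WithLp.toLp 2 fun i =>
      (run W f (phi cφ) (eps τ) (beta cβ) (eta cη) x0 z t).x i k
        - nodeMean (run W f (phi cφ) (eps τ) (beta cβ) (eta cη) x0 z t).x k : Vec n) i
  · have hn' : (n : ℝ) ≠ 0 := by positivity
    have : (WithLp.toLp 2 fun i =>
      (run W f (phi cφ) (eps τ) (beta cβ) (eta cη) x0 z 0).x i k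
        - nodeMean (run W f (phi cφ) (eps τ) (beta cβ) (eta cη) x0 z 0).x k : Vec n) = 0 := by
      ext i
      simp [run, nodeMean_apply, hn']
    rw [this, norm_zero]
  · have hη0 : 0 ≤ eta cη t := by
      rw [eta_eq]
      positivity
    have h := norm_disagreement_succ_le f (eta cη) x0 z (φ := phi cφ) (ε := eps τ)
      (β := beta cβ) (t := t) (k := k) hn hW.doubly_stochastic hη0
      (M := M * ((t : ℝ) + 1) ^ (-(1 / 2) : ℝ)) (by positivity)
      (fun i => (hM z (t + 1) i k).trans
        (mul_le_mul_of_nonneg_left (rpow_neg_succ_le (by norm_num) t) hM0))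
    refine h.trans ?_
    rw [mul_add]
    refine add_le_add le_rfl ((mul_le_of_le_one_left (by positivity) hW.contraction.le).trans
      (le_of_eq ?_))
    rw [eta_eq, show (-(7 / 10) : ℝ) = -(1 / 5) + -(1 / 2) by norm_num,
      Real.rpow_add (by positivity)]
    ring

/-- The average model is at distance at most `(10 / 3) c_η c_φ t^{3/10}`, up to a constant, from
`xstar` in every component: this is the sum of the largest possible step sizes `η_t φ_t`. -/
lemma exists_abs_nodeMean_sub_le (hn : 0 < n) (hW : W ∈ doublyStochastic ℝ (Fin n))
    (hφ : 0 < cφ) (hτ : 0 < τ) (hη : 0 < cη) (hβ0 : 0 ≤ cβ) (hβ1 : cβ < 1) (xstar : Vec d) :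
    ∃ B, ∀ (z : ℕ → Fin n → Vec d) (t : ℕ) (k : Fin d),
      |(nodeMean (run W f (phi cφ) (eps τ) (beta cβ) (eta cη) x0 z t).x - xstar) k|
        ≤ B + 10 / 3 * (cη * cφ) * ((t : ℝ) + 1) ^ (3 / 10 : ℝ) := by
  obtain ⟨M, hM0, hM⟩ := exists_abs_m_le (W := W) (f := f) (cη := cη) (x0 := x0) hφ hτ hβ0 hβ1
  obtain ⟨B, hB⟩ := exists_le_of_increment_le (a := cη * cφ) (C := cη * (cβ * M))
    (by positivity) (by positivity)
  refine ⟨‖x0 - xstar‖ + B, fun z t k => (hB (fun t =>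
    |(nodeMean (run W f (phi cφ) (eps τ) (beta cβ) (eta cη) x0 z t).x - xstar) k|)
    (fun t => ?_) t).trans ?_⟩
  · have hs : (0 : ℝ) < (t : ℝ) + 1 := by positivity
    have hη0 : 0 ≤ eta cη t := by
      rw [eta_eq]
      positivity
    have hm : |nodeMean (run W f (phi cφ) (eps τ) (beta cβ) (eta cη) x0 z (t + 1)).m k|
        ≤ beta cβ t * (M * ((t : ℝ) + 1) ^ (-(1 / 2) : ℝ)) + phi cφ t := by
      refine abs_nodeMean_apply_le hn fun i => ?_
      have h := abs_run_succ_m_le (W := W) f (eta cη) x0 z (φ := phi cφ) (ε := eps τ)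
        (β := beta cβ) (t := t) (by rw [phi_eq]; positivity) (eps_pos hτ t) (beta_nonneg hβ0 t)
        ((beta_le hβ0 t).trans hβ1.le) i k
      refine h.trans ?_
      gcongr
      · exact beta_nonneg hβ0 t
      · exact hM z t i k
    rw [nodeMean_run_succ f _ _ _ _ x0 z hW]
    have e : ∀ u v w : Vec d, (u - eta cη t • v - w) k = (u - w) k - eta cη t * v k := by
      intro u v w
      simp
      ring
    rw [e]
    refine (abs_sub _ _).trans ?_
    rw [abs_mul, abs_of_nonneg hη0, add_assoc]
    gcongr
    refine (mul_le_mul_of_nonneg_left hm hη0).trans (le_of_eq ?_)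
    rw [eta_eq, beta_eq, phi_eq, show (-(7 / 10) : ℝ) = -(1 / 5) + -(1 / 2) by norm_num,
      show (-(6 / 5) : ℝ) = -(1 / 5) + -(1 / 2) + -(1 / 2) by norm_num,
      Real.rpow_add hs, Real.rpow_add hs, Real.rpow_add hs]
    ring
  · have h0 : nodeMean (run W f (phi cφ) (eps τ) (beta cβ) (eta cη) x0 z 0).x = x0 := by
      have hn' : (n : ℝ) ≠ 0 := by positivity
      ext k
      simp [run, nodeMean_apply, hn']
    simp only [h0]
    gcongr
    exact PiLp.norm_apply_le (x0 - xstar) k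

end Bounds

/-! ### Conditioning on the past -/

/-- A function of the past of an independent sequence is independent of the present. -/
lemma indepFun_of_eq_of_lt {Ω α γ : Type*} [MeasurableSpace Ω] [MeasurableSpace α]
    [MeasurableSpace γ] [Inhabited α] {P : Measure Ω} {ξ : ℕ → Ω → α}
    (hξ : ∀ t, Measurable (ξ t)) (hind : iIndepFun ξ P) {t : ℕ} {F : (ℕ → α) → γ}
    (hF : Measurable F) (hpast : ∀ z z' : ℕ → α, (∀ s < t, z s = z' s) → F z = F z') :
    IndepFun (fun ω => F fun s => ξ s ω) (ξ t) P := by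
  have h := hind.indepFun_finset (Finset.range t) {t} (by simp) hξ
  let ext : (Finset.range t → α) → ℕ → α :=
    fun h s => if hs : s ∈ Finset.range t then h ⟨s, hs⟩ else default
  have hext : Measurable ext := by
    refine measurable_pi_lambda _ fun s => ?_
    by_cases hs : s ∈ Finset.range t
    · simpa only [ext, hs, dif_pos] using measurable_pi_apply _
    · simpa only [ext, hs, dif_neg, not_false_eq_true] using measurable_const
  have heval : Measurable fun g : ({t} : Finset ℕ) → α => g ⟨t, Finset.mem_singleton_self t⟩ :=
    measurable_pi_apply _
  have h1 := h.comp (hF.comp hext) heval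
  refine h1.congr (ae_of_all _ fun ω => ?_) (ae_of_all _ fun ω => rfl)
  refine Eq.symm ?_
  refine hpast _ _ fun s hs => ?_
  simp [ext, hs]

section Measurability

variable {n d : ℕ} {W : Matrix (Fin n) (Fin n) ℝ} {f : Fin n → Vec d → ℝ} {φ ε β η : ℕ → ℝ}
  {x0 : Vec d}

lemma run_congr {t : ℕ} {z z' : ℕ → Fin n → Vec d} (h : ∀ s < t, z s = z' s) :
    run W f φ ε β η x0 z t = run W f φ ε β η x0 z' t := by
  induction t with
  | zero => rfl
  | succ t ih =>
    have h1 := ih fun s hs => h s (hs.trans (Nat.lt_succ_self t))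
    simp only [run, h1, h t (Nat.lt_succ_self t)]

lemma measurable_run (hf : ∀ i, Measurable (gradient (f i))) (t : ℕ) :
    (∀ i, Measurable fun z => (run W f φ ε β η x0 z t).x i) ∧
      ∀ i, Measurable fun z => (run W f φ ε β η x0 z t).m i := by
  induction t with
  | zero => exact ⟨fun i => measurable_const, fun i => measurable_const⟩
  | succ t ih =>
    have hm : ∀ i, Measurable fun z => (run W f φ ε β η x0 z (t + 1)).m i := by
      intro i
      have hz : Measurable fun z : ℕ → Fin n → Vec d => z t i := by fun_prop
      have harg := (((hf i).comp (ih.1 i)).add hz).sub (ih.2 i)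
      have hclip : Measurable (clipVec (d := d) (φ t) (ε t)) :=
        (WithLp.measurable_toLp 2 _).comp (measurable_pi_lambda _ fun k =>
          (measurable_clip _ _).comp (by fun_prop))
      exact ((ih.2 i).const_smul (β t)).add ((hclip.comp harg).const_smul (1 - β t))
    refine ⟨fun i => ?_, hm⟩
    simp only [run_succ_x]
    exact Finset.measurable_sum _ fun j _ =>
      ((ih.1 j).sub ((hm j).const_smul (η t))).const_smul (W i j)

end Measurability

/-- Integrating out the noise in a clipped observation, by Fubini. -/
lemma integral_mul_clip_add {Ω : Type*} [MeasurableSpace Ω] {P : Measure Ω}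
    [IsProbabilityMeasure P] {X Y U : Ω → ℝ} (hX : Measurable X) (hY : Measurable Y)
    (hU : Measurable U) (hind : IndepFun (fun ω => (X ω, Y ω)) U P) {B : ℝ}
    (hB : ∀ ω, |X ω| ≤ B) {φ ε : ℝ} (hφ : 0 ≤ φ) (hε : 0 < ε) :
    ∫ ω, X ω * clip φ ε (Y ω + U ω) ∂P
      = φ / √ε * ∫ ω, X ω * meanClip (P.map U) ε (Y ω) ∂P := by
  have hXY : Measurable fun ω => (X ω, Y ω) := hX.prodMk hY
  have : IsProbabilityMeasure (P.map U) := Measure.isProbabilityMeasure_map hU.aemeasurable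
  have : IsProbabilityMeasure (P.map fun ω => (X ω, Y ω)) :=
    Measure.isProbabilityMeasure_map hXY.aemeasurable
  set ν := P.map U with hν
  set Q := P.map fun ω => (X ω, Y ω) with hQ
  have hjoint : P.map (fun ω => ((X ω, Y ω), U ω)) = Q.prod ν :=
    (indepFun_iff_map_prod_eq_prod_map_map hXY.aemeasurable hU.aemeasurable).mp hind
  have hg : Measurable fun q : (ℝ × ℝ) × ℝ => q.1.1 * clip φ ε (q.1.2 + q.2) :=
    (measurable_fst.comp measurable_fst).mul ((measurable_clip φ ε).comp
      ((measurable_snd.comp measurable_fst).add measurable_snd))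
  have hint : Integrable (fun q : (ℝ × ℝ) × ℝ => q.1.1 * clip φ ε (q.1.2 + q.2)) (Q.prod ν) := by
    rw [← hjoint, integrable_map_measure hg.aestronglyMeasurable (hXY.prodMk hU).aemeasurable]
    refine Integrable.of_bound (hg.comp (hXY.prodMk hU)).aestronglyMeasurable (B * φ)
      (ae_of_all _ fun ω => ?_)
    simp only [Function.comp, Real.norm_eq_abs, abs_mul]
    exact mul_le_mul (hB ω) (abs_clip_le hφ hε _) (abs_nonneg _)
      ((abs_nonneg _).trans (hB ω))
  calc ∫ ω, X ω * clip φ ε (Y ω + U ω) ∂P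
      = ∫ q, q.1.1 * clip φ ε (q.1.2 + q.2) ∂(Q.prod ν) := by
        rw [← hjoint, integral_map (hXY.prodMk hU).aemeasurable hg.aestronglyMeasurable]
    _ = ∫ q, q.1 * (φ / √ε * meanClip ν ε q.2) ∂Q := by
        rw [integral_prod _ hint]
        refine integral_congr_ae (ae_of_all _ fun q => ?_)
        simp only [meanClip]
        rw [integral_const_mul, ← integral_const_mul (φ / √ε)]
        simp only [← clip_eq_mul_clip_sqrt hε]
    _ = ∫ ω, X ω * (φ / √ε * meanClip ν ε (Y ω)) ∂P := by
        have hh : Measurable fun q : ℝ × ℝ => q.1 * (φ / √ε * meanClip ν ε q.2) :=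
          measurable_fst.mul (((measurable_meanClip ν ε).comp measurable_snd).const_mul _)
        rw [hQ, integral_map hXY.aemeasurable hh.aestronglyMeasurable]
    _ = _ := by
        rw [← integral_const_mul]
        refine integral_congr_ae (ae_of_all _ fun ω => ?_)
        ring

/-- One step `e ↦ e - η g` of the error, where `g` is a momentum average of `h` and of clipped
observations of `y` under noise independent of `(e, y)`. -/
lemma integral_norm_sub_smul_sq_le {n d : ℕ} {Ω : Type*} [MeasurableSpace Ω] {P : Measure Ω}
    [IsProbabilityMeasure P] {ν : Measure ℝ} [IsProbabilityMeasure ν] {e g h : Ω → Vec d}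
    {y : Ω → Fin n → Fin d → ℝ} {U : Ω → Fin n → Vec d} (he : Measurable e) (hg : Measurable g)
    (hh : Measurable h) (hy : Measurable y) (hU : Measurable U)
    (hind : IndepFun (fun ω => (e ω, y ω)) U P)
    (hlaw : ∀ i k, P.map (fun ω => U ω i k) = ν) {φ ε β η q R B H K : ℝ} (hφ : 0 ≤ φ)
    (hε : 0 < ε) (hβ0 : 0 ≤ β) (hβ1 : β ≤ 1) (hη : 0 ≤ η)
    (hgeq : ∀ ω k, g ω k = β * h ω k
      + (1 - β) * ((1 / (n : ℝ)) * ∑ i, clip φ ε (y ω i k + U ω i k)))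
    (hB : ∀ ω, ‖e ω‖ ≤ B) (hH : ∀ ω, ‖h ω‖ ≤ H) (hK : ∀ ω, ‖g ω‖ ≤ K)
    (hdrift : ∀ ω, q * ‖e ω‖ ^ 2 - R * ‖e ω‖
      ≤ ∑ k, e ω k * ((1 / (n : ℝ)) * ∑ i, meanClip ν ε (y ω i k))) :
    ∫ ω, ‖e ω - η • g ω‖ ^ 2 ∂P
      ≤ (1 - 2 * (1 - β) * (η * φ / √ε) * q) * ∫ ω, ‖e ω‖ ^ 2 ∂P
        + 2 * (η * β * H + (1 - β) * (η * φ / √ε) * R) * ∫ ω, ‖e ω‖ ∂P + η ^ 2 * K ^ 2 := by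
  have hB0 : ∀ ω, 0 ≤ B := fun ω => (norm_nonneg _).trans (hB ω)
  have he_k : ∀ k, Measurable fun ω => e ω k := fun k => by fun_prop
  have hy_ik : ∀ i k, Measurable fun ω => y ω i k := fun i k => by fun_prop
  have hU_ik : ∀ i k, Measurable fun ω => U ω i k := fun i k => by fun_prop
  have habs : ∀ ω k, |e ω k| ≤ B := fun ω k => (PiLp.norm_apply_le (e ω) k).trans (hB ω)
  have ie1 : Integrable (fun ω => ‖e ω‖) P :=
    Integrable.of_bound he.norm.aestronglyMeasurable B (ae_of_all _ fun ω => by simpa using hB ω)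
  have ie2 : Integrable (fun ω => ‖e ω‖ ^ 2) P :=
    Integrable.of_bound (he.norm.pow_const 2).aestronglyMeasurable (B ^ 2)
      (ae_of_all _ fun ω => by
        simp only [norm_pow, norm_norm]
        gcongr
        exact hB ω)
  have ieh : Integrable (fun ω => inner ℝ (e ω) (h ω)) P :=
    Integrable.of_bound (he.inner hh).aestronglyMeasurable (B * H) (ae_of_all _ fun ω =>
      (norm_inner_le_norm _ _).trans
        (mul_le_mul (hB ω) (hH ω) (norm_nonneg _) (hB0 ω)))
  have ieg : Integrable (fun ω => inner ℝ (e ω) (g ω)) P :=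
    Integrable.of_bound (he.inner hg).aestronglyMeasurable (B * K) (ae_of_all _ fun ω =>
      (norm_inner_le_norm _ _).trans
        (mul_le_mul (hB ω) (hK ω) (norm_nonneg _) (hB0 ω)))
  have ig2 : Integrable (fun ω => ‖g ω‖ ^ 2) P :=
    Integrable.of_bound (hg.norm.pow_const 2).aestronglyMeasurable (K ^ 2)
      (ae_of_all _ fun ω => by
        simp only [norm_pow, norm_norm]
        gcongr
        exact hK ω)
  have icl : ∀ i k, Integrable (fun ω => e ω k * clip φ ε (y ω i k + U ω i k)) P := fun i k =>
    Integrable.of_bound ((he_k k).mul ((measurable_clip φ ε).comp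
      ((hy_ik i k).add (hU_ik i k)))).aestronglyMeasurable (B * φ) (ae_of_all _ fun ω => by
        rw [norm_mul]
        exact mul_le_mul (habs ω k) (abs_clip_le hφ hε _) (norm_nonneg _) (hB0 ω))
  have imc : ∀ i k, Integrable (fun ω => e ω k * meanClip ν ε (y ω i k)) P := fun i k =>
    Integrable.of_bound ((he_k k).mul ((measurable_meanClip ν ε).comp
      (hy_ik i k))).aestronglyMeasurable (B * √ε) (ae_of_all _ fun ω => by
        rw [norm_mul]
        refine mul_le_mul (habs ω k) ?_ (norm_nonneg _) (hB0 ω)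
        have h1 : ∀ u, ‖clip (√ε) ε (y ω i k + u)‖ ≤ √ε := fun u =>
          abs_clip_le (Real.sqrt_nonneg ε) hε _
        simpa [meanClip] using norm_integral_le_of_norm_le_const (μ := ν) (ae_of_all _ h1))
  have hone : ∀ i k, ∫ ω, e ω k * clip φ ε (y ω i k + U ω i k) ∂P
      = φ / √ε * ∫ ω, e ω k * meanClip ν ε (y ω i k) ∂P := by
    intro i k
    rw [← hlaw i k]
    refine integral_mul_clip_add (he_k k) (hy_ik i k) (hU_ik i k) ?_ (fun ω => habs ω k) hφ hε
    exact hind.comp (φ := fun p : Vec d × (Fin n → Fin d → ℝ) => (p.1 k, p.2 i k))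
      (ψ := fun u : Fin n → Vec d => u i k) (by fun_prop) (by fun_prop)
  -- the mean of the clipped part of the inner product
  have hmean : ∫ ω, ∑ k, e ω k * ((1 / (n : ℝ)) * ∑ i, clip φ ε (y ω i k + U ω i k)) ∂P
      = φ / √ε * ∫ ω, ∑ k, e ω k * ((1 / (n : ℝ)) * ∑ i, meanClip ν ε (y ω i k)) ∂P := by
    have e1 : ∀ a : Ω → Fin n → Fin d → ℝ,
        (fun ω => ∑ k, e ω k * ((1 / (n : ℝ)) * ∑ i, a ω i k))
          = fun ω => ∑ k, ∑ i, (1 / (n : ℝ)) * (e ω k * a ω i k) := by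
      intro a
      funext ω
      refine Finset.sum_congr rfl fun k _ => ?_
      rw [Finset.mul_sum, Finset.mul_sum]
      exact Finset.sum_congr rfl fun i _ => by ring
    have e2 := e1 fun ω i k => clip φ ε (y ω i k + U ω i k)
    have e3 := e1 fun ω i k => meanClip ν ε (y ω i k)
    rw [e2, e3, integral_finsetSum _ fun k _ => integrable_finsetSum _ fun i _ =>
      (icl i k).const_mul _, integral_finsetSum _ fun k _ => integrable_finsetSum _ fun i _ =>
      (imc i k).const_mul _, Finset.mul_sum]
    refine Finset.sum_congr rfl fun k _ => ?_
    rw [integral_finsetSum _ fun i _ => (icl i k).const_mul _,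
      integral_finsetSum _ fun i _ => (imc i k).const_mul _, Finset.mul_sum]
    refine Finset.sum_congr rfl fun i _ => ?_
    rw [integral_const_mul, integral_const_mul, hone]
    ring
  have icl' : Integrable (fun ω =>
      ∑ k, e ω k * ((1 / (n : ℝ)) * ∑ i, clip φ ε (y ω i k + U ω i k))) P := by
    refine integrable_finsetSum _ fun k _ => ?_
    have := (integrable_finsetSum Finset.univ fun i _ => icl i k).const_mul (1 / (n : ℝ))
    refine this.congr (ae_of_all _ fun ω => ?_)
    simp only [Finset.mul_sum]
    exact Finset.sum_congr rfl fun i _ => by ring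
  have imc' : Integrable (fun ω =>
      ∑ k, e ω k * ((1 / (n : ℝ)) * ∑ i, meanClip ν ε (y ω i k))) P := by
    refine integrable_finsetSum _ fun k _ => ?_
    have := (integrable_finsetSum Finset.univ fun i _ => imc i k).const_mul (1 / (n : ℝ))
    refine this.congr (ae_of_all _ fun ω => ?_)
    simp only [Finset.mul_sum]
    exact Finset.sum_congr rfl fun i _ => by ring
  have hinner : ∀ ω, inner ℝ (e ω) (g ω) = β * inner ℝ (e ω) (h ω)
      + (1 - β) * ∑ k, e ω k * ((1 / (n : ℝ)) * ∑ i, clip φ ε (y ω i k + U ω i k)) := by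
    intro ω
    rw [PiLp.inner_apply, PiLp.inner_apply, Finset.mul_sum, Finset.mul_sum,
      ← Finset.sum_add_distrib]
    refine Finset.sum_congr rfl fun k _ => ?_
    simp only [hgeq, RCLike.inner_apply, conj_trivial]
    ring
  have hdr : q * ∫ ω, ‖e ω‖ ^ 2 ∂P - R * ∫ ω, ‖e ω‖ ∂P
      ≤ ∫ ω, ∑ k, e ω k * ((1 / (n : ℝ)) * ∑ i, meanClip ν ε (y ω i k)) ∂P := by
    rw [← integral_const_mul, ← integral_const_mul,
      ← integral_sub (ie2.const_mul q) (ie1.const_mul R)]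
    exact integral_mono ((ie2.const_mul q).sub (ie1.const_mul R)) imc' hdrift
  have hhb : -(H * ∫ ω, ‖e ω‖ ∂P) ≤ ∫ ω, inner ℝ (e ω) (h ω) ∂P := by
    rw [← integral_const_mul, ← integral_neg]
    refine integral_mono (ie1.const_mul H).neg ieh fun ω => ?_
    have h1 := (abs_le.mp (abs_real_inner_le_norm (e ω) (h ω))).1
    have h2 : ‖e ω‖ * ‖h ω‖ ≤ H * ‖e ω‖ := by
      rw [mul_comm]
      gcongr
      exact hH ω
    simp only
    linarith
  have hgb : ∫ ω, ‖g ω‖ ^ 2 ∂P ≤ K ^ 2 := by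
    have : ∫ ω, ‖g ω‖ ^ 2 ∂P ≤ ∫ _ω, K ^ 2 ∂P :=
      integral_mono ig2 (integrable_const _) fun ω => by
        simp only
        gcongr
        exact hK ω
    simpa using this
  have hexp : ∫ ω, ‖e ω - η • g ω‖ ^ 2 ∂P = ∫ ω, ‖e ω‖ ^ 2 ∂P
      - 2 * η * ∫ ω, inner ℝ (e ω) (g ω) ∂P + η ^ 2 * ∫ ω, ‖g ω‖ ^ 2 ∂P := by
    have i1 : Integrable (fun ω => ‖e ω‖ ^ 2 - 2 * η * inner ℝ (e ω) (g ω)) P :=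
      ie2.sub (ieg.const_mul _)
    rw [← integral_const_mul, ← integral_const_mul, ← integral_sub ie2 (ieg.const_mul _),
      ← integral_add i1 (ig2.const_mul _)]
    refine integral_congr_ae (ae_of_all _ fun ω => ?_)
    simp only [norm_sub_sq_real, inner_smul_right, norm_smul, mul_pow, Real.norm_eq_abs, sq_abs]
    ring
  have hig : ∫ ω, inner ℝ (e ω) (g ω) ∂P = β * ∫ ω, inner ℝ (e ω) (h ω) ∂P
      + (1 - β) * (φ / √ε *
        ∫ ω, ∑ k, e ω k * ((1 / (n : ℝ)) * ∑ i, meanClip ν ε (y ω i k)) ∂P) := by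
    rw [← hmean, ← integral_const_mul, ← integral_const_mul,
      ← integral_add (ieh.const_mul _) (icl'.const_mul _)]
    exact integral_congr_ae (ae_of_all _ hinner)
  rw [hexp, hig]
  have h1 := mul_le_mul_of_nonneg_left hhb (by positivity : 0 ≤ 2 * η * β)
  have h2 := mul_le_mul_of_nonneg_left hdr
    (mul_nonneg (by linarith) (by positivity) : 0 ≤ (1 - β) * (2 * η * (φ / √ε)))
  have h3 := mul_le_mul_of_nonneg_left hgb (sq_nonneg η)
  have e4 : η * φ / √ε = η * (φ / √ε) := by ring
  rw [e4]
  linarith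

/-! ### The law of the noise -/

section Noise

variable {n d : ℕ} {Ω : Type*} [MeasurableSpace Ω] {P : Measure Ω} {ξ : ℕ → Fin n → Ω → Vec d}
  {p : ℝ → ℝ} {σ : ℝ}

lemma IsSymmetricNoise.map_neg (hξ : IsSymmetricNoise P ξ p σ) :
    (volume.withDensity fun u => ENNReal.ofReal (p u)).map (fun u => -u)
      = volume.withDensity fun u => ENNReal.ofReal (p u) := by
  have hp : Measurable fun u => ENNReal.ofReal (p u) := hξ.measurable_density.ennreal_ofReal
  ext s hs
  rw [Measure.map_apply measurable_neg hs, withDensity_apply _ (measurable_neg hs),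
    withDensity_apply _ hs,
    ← (Measure.measurePreserving_neg (volume : Measure ℝ)).setLIntegral_comp_preimage hs hp]
  simp only [hξ.density_symm]

lemma IsSymmetricNoise.integrable_abs (hξ : IsSymmetricNoise P ξ p σ) :
    Integrable (fun u : ℝ => |u|) (volume.withDensity fun u => ENNReal.ofReal (p u)) := by
  rw [integrable_withDensity_iff_integrable_smul' hξ.measurable_density.ennreal_ofReal
    (ae_of_all _ fun _ => ENNReal.ofReal_lt_top)]
  refine hξ.integrable_moment.congr (ae_of_all _ fun u => ?_)
  simp only [ENNReal.toReal_ofReal (hξ.density_nonneg u), smul_eq_mul, mul_comm]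

lemma IsSymmetricNoise.integral_abs_le (hξ : IsSymmetricNoise P ξ p σ) :
    ∫ u : ℝ, |u| ∂(volume.withDensity fun u => ENNReal.ofReal (p u)) ≤ σ := by
  rw [integral_withDensity_eq_integral_toReal_smul hξ.measurable_density.ennreal_ofReal
    (ae_of_all _ fun _ => ENNReal.ofReal_lt_top)]
  refine le_of_eq_of_le (integral_congr_ae (ae_of_all _ fun u => ?_)) hξ.moment_le
  simp only [ENNReal.toReal_ofReal (hξ.density_nonneg u), smul_eq_mul, mul_comm]

end Noise

/-! ### The recursion for the mean squared error -/

lemma rpow_five_halves {κ : ℝ} (hκ : 0 < κ) : κ ^ (5 / 2 : ℝ) = κ ^ 2 * √κ := by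
  rw [show (5 / 2 : ℝ) = 2 + 1 / 2 by norm_num, Real.rpow_add hκ, Real.sqrt_eq_rpow]
  norm_num

/-- With `98 A ≤ b`, gradients of size `5 L √d c_η c_φ t^{3/10}` are small enough compared with
`√ε_t` for clipping to distort them by a fraction of `κ^{-1/2}` only. -/
lemma clipping_distortion_le {A b μ L σ τ X D : ℝ} (hb : 0 < b) (hAb : 98 * A ≤ b)
    (hμ : 0 < μ) (hL : μ ≤ L) (hσ : 0 < σ) (hD : 0 < D) (hX : X ≤ A * (σ ^ 2 / μ ^ 2))
    (hτ : b * (D * σ ^ 2 * (L / μ) ^ (5 / 2 : ℝ)) ≤ τ) :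
    3 * (25 * L ^ 2 * D * X / τ) * √(L / μ) ≤ 75 / 98 := by
  have hL0 : 0 < L := hμ.trans_le hL
  have hκ : 0 < L / μ := by positivity
  rw [rpow_five_halves hκ] at hτ
  have hτ0 : 0 < τ := lt_of_lt_of_le (by positivity) hτ
  have h1 : 3 * (25 * L ^ 2 * D * X / τ) * √(L / μ) = 75 * L ^ 2 * D * √(L / μ) * X / τ := by
    ring
  rw [h1, div_le_iff₀ hτ0]
  calc 75 * L ^ 2 * D * √(L / μ) * X
      ≤ 75 * L ^ 2 * D * √(L / μ) * (A * (σ ^ 2 / μ ^ 2)) := by gcongr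
    _ = 75 / 98 * (98 * A * (D * σ ^ 2 * ((L / μ) ^ 2 * √(L / μ)))) := by
        field_simp
    _ ≤ 75 / 98 * (b * (D * σ ^ 2 * ((L / μ) ^ 2 * √(L / μ)))) := by gcongr
    _ ≤ 75 / 98 * τ := by gcongr

/-- The effective step size `c_η c_φ / √τ`, in units of `1 / μ`, is of order `d^{-1/2} κ^{-5/4}`. -/
lemma rate_le_effective_step {a B μ L σ τ C D : ℝ} (ha : 0 < a) (hB : 0 < B) (hμ : 0 < μ)
    (hL : μ ≤ L) (hσ : 0 < σ) (hD : 0 < D) (hC : 0 < C) (hX : a * (σ ^ 2 / μ ^ 2) ≤ C ^ 2)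
    (hτ0 : 0 < τ) (hτ : τ ≤ B * (D * σ ^ 2 * (L / μ) ^ (5 / 2 : ℝ))) :
    √(a / B) * D ^ (-(1 / 2) : ℝ) * (L / μ) ^ (-(5 / 4) : ℝ) ≤ μ * (C / √τ) := by
  have hL0 : 0 < L := hμ.trans_le hL
  have hκ : 0 < L / μ := by positivity
  set κ := L / μ with hκdef
  refine le_of_sq_le_sq ?_ (by positivity)
  have e1 : (D ^ (-(1 / 2) : ℝ)) ^ 2 = D⁻¹ := by
    rw [← Real.rpow_natCast, ← Real.rpow_mul hD.le]
    norm_num [Real.rpow_neg_one]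
  have e2 : (κ ^ (-(5 / 4) : ℝ)) ^ 2 = (κ ^ (5 / 2 : ℝ))⁻¹ := by
    rw [← Real.rpow_natCast, ← Real.rpow_mul hκ.le, ← Real.rpow_neg hκ.le]
    norm_num
  rw [mul_pow, mul_pow, mul_pow, div_pow, Real.sq_sqrt (by positivity), Real.sq_sqrt hτ0.le, e1,
    e2]
  set w := κ ^ (5 / 2 : ℝ) with hw
  have hw0 : 0 < w := by positivity
  calc a / B * D⁻¹ * w⁻¹ = μ ^ 2 * (a * (σ ^ 2 / μ ^ 2)) / (B * (D * σ ^ 2 * w)) := by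
        field_simp
    _ ≤ μ ^ 2 * C ^ 2 / τ := by gcongr
    _ = μ ^ 2 * (C ^ 2 / τ) := by ring

section Recursion

variable {n d : ℕ} {f : Fin n → Vec d → ℝ} {W : Matrix (Fin n) (Fin n) ℝ} {G : Digraph (Fin n)}
  {μ L cstar σ cφ τ cβ cη : ℝ} {xstar x0 : Vec d} {ν : Measure ℝ}

/-- Eventually, along every realization of the noise, the mean update direction points towards the
minimizer up to an error of order `t^{-3/10}`. -/
lemma eventually_drift [IsProbabilityMeasure ν] (hn : 0 < n) (hd : 0 < d) (hμ : 0 < μ)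
    (hL : μ ≤ L) (hf : ∀ i, HessianBetween μ L (f i))
    (hmin : IsMinOn (average f) Set.univ xstar) (hc : ∀ i k, |gradient (f i) xstar k| ≤ cstar)
    (hsymm : ν.map (fun u => -u) = ν) (hint : Integrable (fun u : ℝ => |u|) ν)
    (hmom : ∫ u : ℝ, |u| ∂ν ≤ σ) (hW : IsMixing G W) (hφ : 0 < cφ) (hτ : 0 < τ) (hη : 0 < cη)
    (hβ0 : 0 ≤ cβ) (hβ1 : cβ < 1)
    (hdist : 3 * (25 * L ^ 2 * d * (cη ^ 2 * cφ ^ 2) / τ) * √(L / μ) ≤ 75 / 98) :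
    ∃ D, 0 ≤ D ∧ ∀ᶠ t : ℕ in atTop, ∀ z : ℕ → Fin n → Vec d,
      let s := run W f (phi cφ) (eps τ) (beta cβ) (eta cη) x0 z t
      μ / 5 * ‖nodeMean s.x - xstar‖ ^ 2
          - D * ((t : ℝ) + 1) ^ (-(3 / 10) : ℝ) * ‖nodeMean s.x - xstar‖
        ≤ ∑ k, (nodeMean s.x - xstar) k * ((1 / (n : ℝ)) * ∑ i,
            meanClip ν (eps τ t) (gradient (f i) (s.x i) k - s.m i k)) := by
  have hL0 : 0 < L := hμ.trans_le hL
  have hd' : (0 : ℝ) < d := by exact_mod_cast hd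
  have hσ0 : 0 ≤ σ := le_trans (integral_nonneg fun u => abs_nonneg u) hmom
  have hc0 : 0 ≤ cstar := (abs_nonneg _).trans (hc ⟨0, hn⟩ ⟨0, hd⟩)
  obtain ⟨M, hM0, hM⟩ := exists_abs_m_le (W := W) (f := f) (cη := cη) (x0 := x0) hφ hτ hβ0 hβ1
  obtain ⟨K, hK0, hK⟩ := exists_abs_x_sub_nodeMean_le (f := f) (x0 := x0) hn hW hφ hτ hη hβ0 hβ1
  obtain ⟨B, hB⟩ := exists_abs_nodeMean_sub_le (f := f) (x0 := x0) hn hW.doubly_stochastic hφ hτ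
    hη hβ0 hβ1 xstar
  set ζ := L * (√d * K) + M with hζ
  set b := (3 * (cstar ^ 2 / τ) + 2 * (σ / √τ)) * cstar with hb
  refine ⟨d * (ζ + b), by positivity, ?_⟩
  -- `5 / 3 = 5 - 10 / 3` is the slack left for the terms of lower order
  have hlim1 : Tendsto (fun t : ℕ => 5 / 3 * L * √d * (cη * cφ) * ((t : ℝ) + 1) ^ (3 / 10 : ℝ))
      atTop atTop :=
    ((tendsto_rpow_atTop (by norm_num : (0 : ℝ) < 3 / 10)).comp
      (tendsto_atTop_add_const_right _ _ tendsto_natCast_atTop_atTop)).const_mul_atTop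
      (by positivity)
  have hlim2 : Tendsto (fun t : ℕ => 2 * (σ / √τ) * √(L / μ) * ((t : ℝ) + 1) ^ (-(3 / 10) : ℝ))
      atTop (𝓝 0) := by
    simpa using (tendsto_rpow_neg (by norm_num : (0 : ℝ) < 3 / 10)).const_mul
      (2 * (σ / √τ) * √(L / μ))
  filter_upwards [hlim1.eventually_ge_atTop (L * (√d * |B|) + cstar),
    hlim2.eventually_le_const (by norm_num : (0 : ℝ) < 1 / 50)] with t ht1 ht2 z
  intro s
  have hs : (0 : ℝ) < (t : ℝ) + 1 := by positivity
  set T := ((t : ℝ) + 1) ^ (3 / 10 : ℝ) with hT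
  have hT0 : 0 < T := by positivity
  have hT1 : ((t : ℝ) + 1) ^ (-(3 / 10) : ℝ) = T⁻¹ := by rw [Real.rpow_neg hs.le]
  have hεT : eps τ t = τ * T ^ 2 := by
    rw [eps, hT, ← Real.rpow_natCast, ← Real.rpow_mul hs.le]
    norm_num
  have hsqrt : √(eps τ t) = √τ * T := sqrt_eps hτ t
  have hT_le : T⁻¹ ≤ 1 := by
    rw [← hT1]
    exact rpow_neg_le_one (by norm_num) t
  set r := 5 * L * √d * (cη * cφ) * T with hr
  have he : ‖nodeMean s.x - xstar‖ ≤ √d * (|B| + 10 / 3 * (cη * cφ) * T) :=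
    norm_le_sqrt_mul (by positivity) fun k =>
      (hB z t k).trans (add_le_add (le_abs_self B) le_rfl)
  have hgr : L * ‖nodeMean s.x - xstar‖ + cstar ≤ r := by
    have := mul_le_mul_of_nonneg_left he hL0.le
    rw [hr]
    linarith
  have hcr : cstar ≤ r := by
    have : 0 ≤ L * ‖nodeMean s.x - xstar‖ := by positivity
    linarith
  have hθ : (3 * (r ^ 2 / eps τ t) + 2 * (σ / √(eps τ t))) * √(L / μ) ≤ 4 / 5 := by
    have e1 : r ^ 2 / eps τ t = 25 * L ^ 2 * d * (cη ^ 2 * cφ ^ 2) / τ := by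
      have : √(d : ℝ) ^ 2 = d := Real.sq_sqrt hd'.le
      rw [hr, hεT]
      field_simp
      rw [this]
      ring
    have e2 : 2 * (σ / √(eps τ t)) * √(L / μ) = 2 * (σ / √τ) * √(L / μ) * T⁻¹ := by
      rw [hsqrt]
      field_simp
    rw [add_mul, e1, e2]
    -- `75 / 98 + 1 / 50 ≤ 4 / 5`
    rw [hT1] at ht2
    linarith
  have hx : ∀ i k, |gradient (f i) (nodeMean s.x) k| ≤ r := by
    intro i k
    have h1 : |(gradient (f i) (nodeMean s.x) - gradient (f i) xstar) k|
        ≤ L * ‖nodeMean s.x - xstar‖ :=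
      (PiLp.norm_apply_le _ k).trans ((hf i).norm_gradient_sub_le hμ hL _ _)
    have h2 : gradient (f i) (nodeMean s.x) k
        = (gradient (f i) (nodeMean s.x) - gradient (f i) xstar) k + gradient (f i) xstar k := by
      simp
    rw [h2]
    exact (abs_add_le _ _).trans ((add_le_add h1 (hc i k)).trans hgr)
  have hy : ∀ i k, |gradient (f i) (s.x i) k - s.m i k - gradient (f i) (nodeMean s.x) k|
      ≤ ζ * T⁻¹ := by
    intro i k
    have h1 : ‖s.x i - nodeMean s.x‖ ≤ √d * (K * T⁻¹) := by
      refine norm_le_sqrt_mul (by positivity) fun k => (hK z t i k).trans ?_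
      rw [← hT1]
      gcongr ?_ * ?_
      exact rpow_neg_le_rpow_neg (by norm_num) t
    have h2 : |(gradient (f i) (s.x i) - gradient (f i) (nodeMean s.x)) k|
        ≤ L * (√d * (K * T⁻¹)) :=
      (PiLp.norm_apply_le _ k).trans (((hf i).norm_gradient_sub_le hμ hL _ _).trans
        (by gcongr))
    have h3 : |s.m i k| ≤ M * T⁻¹ := by
      refine (hM z t i k).trans ?_
      rw [← hT1]
      gcongr ?_ * ?_
      exact rpow_neg_le_rpow_neg (by norm_num) t
    have h4 : gradient (f i) (s.x i) k - s.m i k - gradient (f i) (nodeMean s.x) k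
        = (gradient (f i) (s.x i) - gradient (f i) (nodeMean s.x)) k - s.m i k := by
      simp only [PiLp.sub_apply]
      ring
    rw [h4, hζ]
    refine (abs_sub _ _).trans ?_
    linarith
  have hmain := le_sum_mul_average_meanClip hn hμ hL hf hmin hsymm hint hmom (eps_pos hτ t) hc0
    hcr (by norm_num : (4 / 5 : ℝ) ≤ 1) hθ hc hx hy
  refine le_trans ?_ hmain
  have hbT : (3 * (cstar ^ 2 / eps τ t) + 2 * (σ / √(eps τ t))) * cstar ≤ b * T⁻¹ := by
    have e1 : cstar ^ 2 / eps τ t ≤ cstar ^ 2 / τ * T⁻¹ := by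
      have : cstar ^ 2 / eps τ t = cstar ^ 2 / τ * T⁻¹ * T⁻¹ := by
        rw [hεT]
        field_simp
      rw [this]
      exact mul_le_of_le_one_right (by positivity) hT_le
    have e2 : σ / √(eps τ t) = σ / √τ * T⁻¹ := by
      rw [hsqrt]
      field_simp
    rw [e2, hb]
    calc _ ≤ (3 * (cstar ^ 2 / τ * T⁻¹) + 2 * (σ / √τ * T⁻¹)) * cstar := by gcongr
      _ = _ := by ring
  have hfin : d * (ζ * T⁻¹ + (3 * (cstar ^ 2 / eps τ t) + 2 * (σ / √(eps τ t))) * cstar)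
      * ‖nodeMean s.x - xstar‖ ≤ d * (ζ + b) * T⁻¹ * ‖nodeMean s.x - xstar‖ := by
    refine mul_le_mul_of_nonneg_right ?_ (norm_nonneg _)
    have := mul_le_mul_of_nonneg_left hbT hd'.le
    linarith
  rw [hT1]
  linarith

/-- The mean squared error of the average model contracts by `1 - c / (t + 1)` up to errors of
order `(t + 1)^{-7/5}`: the squared steps, and by Young's inequality the biases of the
mean update. -/
lemma exists_recursion {Ω : Type*} [MeasurableSpace Ω] {P : Measure Ω} [IsProbabilityMeasure P]
    {ξ : ℕ → Fin n → Ω → Vec d} {p : ℝ → ℝ} (hn : 0 < n) (hd : 0 < d) (hμ : 0 < μ)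
    (hL : μ ≤ L) (hf : ∀ i, HessianBetween μ L (f i))
    (hmin : IsMinOn (average f) Set.univ xstar) (hc : ∀ i k, |gradient (f i) xstar k| ≤ cstar)
    (hξ : IsSymmetricNoise P ξ p σ) (hW : IsMixing G W) (hφ : 0 < cφ) (hτ : 0 < τ) (hη : 0 < cη)
    (hβ0 : 0 ≤ cβ) (hβ1 : cβ < 1)
    (hdist : 3 * (25 * L ^ 2 * d * (cη ^ 2 * cφ ^ 2) / τ) * √(L / μ) ≤ 75 / 98) :
    let V : ℕ → ℝ := fun t => ∫ ω, ‖nodeMean (run W f (phi cφ) (eps τ) (beta cβ) (eta cη) x0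
      (fun s j => ξ s j ω) t).x - xstar‖ ^ 2 ∂P
    ∃ C T, 0 ≤ C ∧ ∀ t ≥ T, V (t + 1)
      ≤ (1 - μ * (cη * cφ / √τ) / 10 / ((t : ℝ) + 1)) * V t
        + C * ((t : ℝ) + 1) ^ (-(7 / 5) : ℝ) := by
  intro V
  have hd' : (0 : ℝ) < d := by exact_mod_cast hd
  set ν : Measure ℝ := volume.withDensity fun u => ENNReal.ofReal (p u) with hν
  have hlaw : ∀ t i k, P.map (fun ω => ξ t i ω k) = ν := hξ.marginal
  have hνprob : IsProbabilityMeasure ν := by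
    rw [← hlaw 0 ⟨0, hn⟩ ⟨0, hd⟩]
    have := hξ.measurable_noise 0 ⟨0, hn⟩
    exact Measure.isProbabilityMeasure_map (by fun_prop)
  obtain ⟨M, hM0, hM⟩ := exists_abs_m_le (W := W) (f := f) (cη := cη) (x0 := x0) hφ hτ hβ0 hβ1
  obtain ⟨B, hB⟩ := exists_abs_nodeMean_sub_le (f := f) (x0 := x0) hn hW.doubly_stochastic hφ hτ
    hη hβ0 hβ1 xstar
  obtain ⟨D, hD0, hdrift⟩ := eventually_drift (x0 := x0) hn hd hμ hL hf hmin hc hξ.map_neg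
    hξ.integrable_abs hξ.integral_abs_le hW hφ hτ hη hβ0 hβ1 hdist
  have hβev : ∀ᶠ t : ℕ in atTop, beta cβ t ≤ 1 / 2 := by
    have : Tendsto (beta cβ) atTop (𝓝 0) := by
      have h := (tendsto_rpow_neg (by norm_num : (0 : ℝ) < 1 / 2)).const_mul cβ
      simpa only [← beta_eq, mul_zero] using h
    exact this.eventually_le_const (by norm_num)
  obtain ⟨T, hT⟩ := eventually_atTop.mp (hdrift.and hβev)
  set γ := cη * cφ / √τ with hγ
  have hγ0 : 0 < γ := by positivity
  set w := μ * γ / 10 with hw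
  have hw0 : 0 < w := by positivity
  set C1 := cη * cβ * (√d * M) + γ * D + 1 with hC1
  have hC10 : 0 < C1 := by positivity
  refine ⟨C1 ^ 2 / w + cη ^ 2 * (√d * M) ^ 2, T, by positivity, fun t ht => ?_⟩
  obtain ⟨hdr, hβhalf⟩ := hT t ht
  have hs : (0 : ℝ) < (t : ℝ) + 1 := by positivity
  have hgradm : ∀ i, Measurable (gradient (f i)) := fun i => (hf i).measurable_gradient
  set N : Ω → ℕ → Fin n → Vec d := fun ω s j => ξ s j ω with hN
  have hNm : Measurable N :=
    measurable_pi_lambda _ fun s => measurable_pi_lambda _ fun j => hξ.measurable_noise s j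
  set S : (ℕ → Fin n → Vec d) → ℕ → State n d := fun z t =>
    run W f (phi cφ) (eps τ) (beta cβ) (eta cη) x0 z t with hS
  have hrun : ∀ t, (∀ i, Measurable fun z => (S z t).x i) ∧ ∀ i, Measurable fun z => (S z t).m i :=
    fun t => measurable_run hgradm t
  have hxm : ∀ t, Measurable fun z => nodeMean (S z t).x := fun t =>
    (Finset.measurable_sum _ fun i _ => (hrun t).1 i).const_smul (1 / (n : ℝ))
  have hmm : ∀ t, Measurable fun z => nodeMean (S z t).m := fun t =>
    (Finset.measurable_sum _ fun i _ => (hrun t).2 i).const_smul (1 / (n : ℝ))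
  -- the error of the average model together with the noiseless arguments of the clipping operator
  set F : (ℕ → Fin n → Vec d) → Vec d × (Fin n → Fin d → ℝ) := fun z =>
    (nodeMean (S z t).x - xstar,
      fun i k => gradient (f i) ((S z t).x i) k - (S z t).m i k) with hF
  have hFm : Measurable F := by
    refine ((hxm t).sub_const xstar).prodMk (measurable_pi_lambda _ fun i =>
      measurable_pi_lambda _ fun k => ?_)
    have h1 := (hgradm i).comp ((hrun t).1 i)
    have h2 := (hrun t).2 i
    exact (show Measurable fun z => gradient (f i) ((S z t).x i) k by
      simp only [Function.comp_def] at h1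
      fun_prop).sub (by fun_prop)
  have hind : IndepFun (fun ω => F (N ω)) (fun ω i => ξ t i ω) P :=
    indepFun_of_eq_of_lt (ξ := fun t ω i => ξ t i ω)
      (fun t => measurable_pi_lambda _ fun i => hξ.measurable_noise t i) hξ.indep hFm
      fun z z' h => by simp only [hF, hS, run_congr h]
  have hmbound : ∀ z t, ‖nodeMean (S z t).m‖ ≤ √d * (M * ((t : ℝ) + 1) ^ (-(1 / 2) : ℝ)) :=
    fun z t => norm_le_sqrt_mul (by positivity) fun k =>
      abs_nodeMean_apply_le hn fun i => hM z t i k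
  have hη0 : 0 ≤ eta cη t := by
    rw [eta_eq]
    positivity
  have hstep := integral_norm_sub_smul_sq_le (P := P) (ν := ν) (e := fun ω => (F (N ω)).1)
    (g := fun ω => nodeMean (S (N ω) (t + 1)).m) (h := fun ω => nodeMean (S (N ω) t).m)
    (y := fun ω => (F (N ω)).2) (U := fun ω i => ξ t i ω) (φ := phi cφ t) (ε := eps τ t)
    (β := beta cβ t) (η := eta cη t) (q := μ / 5) (R := D * ((t : ℝ) + 1) ^ (-(3 / 10) : ℝ))
    (B := √d * (|B| + 10 / 3 * (cη * cφ) * ((t : ℝ) + 1) ^ (3 / 10 : ℝ)))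
    (H := √d * (M * ((t : ℝ) + 1) ^ (-(1 / 2) : ℝ)))
    (K := √d * (M * ((t : ℝ) + 1) ^ (-(1 / 2) : ℝ)))
    (hFm.comp hNm).fst ((hmm (t + 1)).comp hNm) ((hmm t).comp hNm) (hFm.comp hNm).snd
    (measurable_pi_lambda _ fun i => hξ.measurable_noise t i) hind (fun i k => hlaw t i k)
    (by rw [phi_eq]; positivity) (eps_pos hτ t) (beta_nonneg hβ0 t)
    ((beta_le hβ0 t).trans hβ1.le) hη0
    (fun ω k => by
      rw [nodeMean_apply, nodeMean_apply]
      simp only [hS, run_succ_m_apply, Finset.sum_add_distrib, ← Finset.mul_sum, hF, hN]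
      ring)
    (fun ω => norm_le_sqrt_mul (by positivity) fun k =>
      (hB (N ω) t k).trans (add_le_add (le_abs_self B) le_rfl))
    (fun ω => hmbound (N ω) t)
    (fun ω => (hmbound (N ω) (t + 1)).trans (by
      gcongr √d * (M * ?_)
      exact rpow_neg_succ_le (by norm_num) t))
    (fun ω => hdr (N ω))
  have hnext : ∀ ω, (F (N ω)).1 - eta cη t • nodeMean (S (N ω) (t + 1)).m
      = nodeMean (S (N ω) (t + 1)).x - xstar := by
    intro ω
    simp only [hF, hS]
    rw [nodeMean_run_succ f _ _ _ _ x0 (N ω) hW.doubly_stochastic]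
    abel
  simp only [hnext] at hstep
  have hVt : ∫ ω, ‖(F (N ω)).1‖ ^ 2 ∂P = V t := rfl
  have hVt1 : ∫ ω, ‖nodeMean (S (N ω) (t + 1)).x - xstar‖ ^ 2 ∂P = V (t + 1) := rfl
  rw [hVt, hVt1] at hstep
  set E := ∫ ω, ‖(F (N ω)).1‖ ∂P with hE
  have hE0 : 0 ≤ E := integral_nonneg fun ω => norm_nonneg _
  have hV0 : 0 ≤ V t := integral_nonneg fun ω => sq_nonneg _
  have hEV : ∀ q : ℝ, 0 < q → 2 * E ≤ q * V t + 1 / q := by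
    intro q hq
    have hbd : ∀ ω, ‖(F (N ω)).1‖
        ≤ √d * (|B| + 10 / 3 * (cη * cφ) * ((t : ℝ) + 1) ^ (3 / 10 : ℝ)) := fun ω =>
      norm_le_sqrt_mul (by positivity) fun k =>
        (hB (N ω) t k).trans (add_le_add (le_abs_self B) le_rfl)
    have hem : Measurable fun ω => (F (N ω)).1 := (hFm.comp hNm).fst
    have i1 : Integrable (fun ω => ‖(F (N ω)).1‖) P :=
      Integrable.of_bound hem.norm.aestronglyMeasurable _
        (ae_of_all _ fun ω => by simpa only [norm_norm] using hbd ω)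
    have i2 : Integrable (fun ω => ‖(F (N ω)).1‖ ^ 2) P :=
      Integrable.of_bound (hem.norm.pow_const 2).aestronglyMeasurable
        ((√d * (|B| + 10 / 3 * (cη * cφ) * ((t : ℝ) + 1) ^ (3 / 10 : ℝ))) ^ 2)
        (ae_of_all _ fun ω => by
          simp only [norm_pow, norm_norm]
          gcongr
          exact hbd ω)
    have h1 : ∫ ω, 2 * ‖(F (N ω)).1‖ ∂P ≤ ∫ ω, (q * ‖(F (N ω)).1‖ ^ 2 + 1 / q) ∂P := by
      refine integral_mono (i1.const_mul 2) ((i2.const_mul q).add (integrable_const _)) fun ω => ?_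
      have h2 : 0 ≤ (q * ‖(F (N ω)).1‖ - 1) ^ 2 / q := by positivity
      have h3 : (q * ‖(F (N ω)).1‖ - 1) ^ 2 / q
          = q * ‖(F (N ω)).1‖ ^ 2 - 2 * ‖(F (N ω)).1‖ + 1 / q := by
        field_simp
        ring
      simp only
      linarith
    rw [integral_const_mul, integral_add (i2.const_mul q) (integrable_const _),
      integral_const_mul, hVt] at h1
    simpa using h1
  set s := (t : ℝ) + 1 with hsdef
  have hstep1 : eta cη t * phi cφ t / √(eps τ t) = γ / s := by
    have e1 : s ^ (-(1 / 5) : ℝ) * s ^ (-(1 / 2) : ℝ) = s⁻¹ * s ^ (3 / 10 : ℝ) := by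
      rw [← Real.rpow_neg_one s, ← Real.rpow_add hs, ← Real.rpow_add hs]
      norm_num
    have h3 : s ^ (3 / 10 : ℝ) ≠ 0 := by positivity
    rw [eta_eq, phi_eq, sqrt_eps hτ, hγ, ← hsdef]
    calc cη * s ^ (-(1 / 5) : ℝ) * (cφ * s ^ (-(1 / 2) : ℝ)) / (√τ * s ^ (3 / 10 : ℝ))
        = cη * cφ * (s ^ (-(1 / 5) : ℝ) * s ^ (-(1 / 2) : ℝ)) / (√τ * s ^ (3 / 10 : ℝ)) := by ring
      _ = _ := by
        rw [e1]
        field_simp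
  have hstep2 : eta cη t * beta cβ t * (√d * (M * s ^ (-(1 / 2) : ℝ)))
      = cη * cβ * (√d * M) * s ^ (-(6 / 5) : ℝ) := by
    rw [eta_eq, beta_eq, show (-(6 / 5) : ℝ) = -(1 / 5) + -(1 / 2) + -(1 / 2) by norm_num,
      Real.rpow_add hs, Real.rpow_add hs]
    ring
  have hstep3 : γ / s * (D * s ^ (-(3 / 10) : ℝ)) ≤ γ * D * s ^ (-(6 / 5) : ℝ) := by
    have e1 : γ / s * (D * s ^ (-(3 / 10) : ℝ)) = γ * D * s ^ (-(13 / 10) : ℝ) := by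
      rw [show (-(13 / 10) : ℝ) = -1 + -(3 / 10) by norm_num, Real.rpow_add hs, Real.rpow_neg_one]
      ring
    rw [e1]
    gcongr ?_ * ?_
    exact rpow_neg_le_rpow_neg (by norm_num) t
  have hstep4 : eta cη t ^ 2 * (√d * (M * s ^ (-(1 / 2) : ℝ))) ^ 2
      = cη ^ 2 * (√d * M) ^ 2 * s ^ (-(7 / 5) : ℝ) := by
    rw [eta_eq, show (-(7 / 5) : ℝ) = -(1 / 5) + -(1 / 5) + -(1 / 2) + -(1 / 2) by norm_num,
      Real.rpow_add hs, Real.rpow_add hs, Real.rpow_add hs]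
    ring
  -- Young's inequality spends half of the contraction `2 w / s` on the linear terms
  have hyoung : s ^ (-(6 / 5) : ℝ) * (2 * (C1 * E))
      ≤ w / s * V t + C1 ^ 2 / w * s ^ (-(7 / 5) : ℝ) := by
    have h15 : 0 < s ^ (1 / 5 : ℝ) := by positivity
    have h1 := mul_le_mul_of_nonneg_left (hEV (w * s ^ (1 / 5 : ℝ) / C1) (by positivity))
      (by positivity : 0 ≤ s ^ (-(6 / 5) : ℝ) * C1)
    have e1 : s ^ (-(6 / 5) : ℝ) = s⁻¹ * (s ^ (1 / 5 : ℝ))⁻¹ := by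
      rw [← Real.rpow_neg_one s, ← Real.rpow_neg hs.le, ← Real.rpow_add hs]
      norm_num
    have e2 : s ^ (-(7 / 5) : ℝ) = s⁻¹ * (s ^ (1 / 5 : ℝ))⁻¹ * (s ^ (1 / 5 : ℝ))⁻¹ := by
      rw [← Real.rpow_neg_one s, ← Real.rpow_neg hs.le, ← Real.rpow_add hs, ← Real.rpow_add hs]
      norm_num
    have e3 : s ^ (-(6 / 5) : ℝ) * C1 * (w * s ^ (1 / 5 : ℝ) / C1 * V t
        + 1 / (w * s ^ (1 / 5 : ℝ) / C1)) = w / s * V t + C1 ^ 2 / w * s ^ (-(7 / 5) : ℝ) := by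
      rw [e1, e2]
      field_simp
    rw [e3] at h1
    linarith
  rw [hstep1, hstep2, hstep4] at hstep
  have hβn := beta_nonneg hβ0 t
  have hγs : 0 < γ / s := by positivity
  have hA : (1 - 2 * (1 - beta cβ t) * (γ / s) * (μ / 5)) * V t
      ≤ (1 - 2 * (w / s)) * V t := by
    refine mul_le_mul_of_nonneg_right ?_ hV0
    have e : 2 * (w / s) = γ / s * (μ / 5) := by
      rw [hw]
      ring
    rw [e]
    have : 0 ≤ (1 - 2 * beta cβ t) * (γ / s * (μ / 5)) :=
      mul_nonneg (by linarith) (by positivity)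
    linarith
  have hBd : 2 * (cη * cβ * (√d * M) * s ^ (-(6 / 5) : ℝ)
      + (1 - beta cβ t) * (γ / s) * (D * s ^ (-(3 / 10) : ℝ))) * E
      ≤ s ^ (-(6 / 5) : ℝ) * (2 * (C1 * E)) := by
    have h1 : (1 - beta cβ t) * (γ / s * (D * s ^ (-(3 / 10) : ℝ)))
        ≤ 1 * (γ * D * s ^ (-(6 / 5) : ℝ)) :=
      mul_le_mul (by linarith) hstep3 (by positivity) (by norm_num)
    have h2 : 0 ≤ s ^ (-(6 / 5) : ℝ) := by positivity
    have h3 : cη * cβ * (√d * M) * s ^ (-(6 / 5) : ℝ)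
        + (1 - beta cβ t) * (γ / s) * (D * s ^ (-(3 / 10) : ℝ)) ≤ C1 * s ^ (-(6 / 5) : ℝ) := by
      rw [hC1]
      linarith
    have h4 := mul_le_mul_of_nonneg_right h3 hE0
    linarith
  have hgoal : μ * γ / 10 / s = w / s := rfl
  rw [hgoal]
  linarith

end Recursion

end

end SClip

/-! ### The rate of convergence of every node -/

theorem theorem1 :
    -- the constants hidden in the two `Θ` conditions on the parameters
    ∀ a A b B : ℝ, 0 < a → a ≤ A → 0 < b → b ≤ B → 98 * A ≤ b →
    ∃ cs : ℕ → ℝ → ℝ,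
      -- `c_s = Ω(d^{-1/2} κ^{-5/4})`
      (∃ c : ℝ, 0 < c ∧ ∀ (d : ℕ) (κ : ℝ), 1 ≤ d → 1 ≤ κ →
        c * (d : ℝ) ^ (-(1 / 2) : ℝ) * κ ^ (-(5 / 4) : ℝ) ≤ cs d κ) ∧
      ∀ (n d : ℕ) (_ : 1 ≤ d)
        -- the local functions and the minimizer of their average
        (f : Fin n → SClip.Vec d → ℝ) (μ L : ℝ) (_ : 0 < μ) (_ : μ ≤ L)
        (_ : ∀ i, SClip.HessianBetween μ L (f i))
        (xstar : SClip.Vec d) (_ : IsMinOn (SClip.average f) Set.univ xstar)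
        (cstar : ℝ) (_ : ∀ i k, |gradient (f i) xstar k| ≤ cstar)
        -- the gradient noise
        {Ω : Type*} [MeasurableSpace Ω] (P : Measure Ω) [IsProbabilityMeasure P]
        (ξ : ℕ → Fin n → Ω → SClip.Vec d) (p : ℝ → ℝ) (σ : ℝ) (_ : 0 < σ)
        (_ : SClip.IsSymmetricNoise P ξ p σ)
        -- the network
        (G : Digraph (Fin n)) (W : Matrix (Fin n) (Fin n) ℝ) (_ : SClip.IsMixing G W)
        -- the parameters and the common initial point
        (cφ τ cβ cη : ℝ) (_ : 0 < cφ) (_ : 0 < cη) (_ : 0 ≤ cβ) (_ : cβ < 1)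
        (_ : a * (σ ^ 2 / μ ^ 2) ≤ cη ^ 2 * cφ ^ 2) (_ : cη ^ 2 * cφ ^ 2 ≤ A * (σ ^ 2 / μ ^ 2))
        (_ : b * ((d : ℝ) * σ ^ 2 * (L / μ) ^ (5 / 2 : ℝ)) ≤ τ)
        (_ : τ ≤ B * ((d : ℝ) * σ ^ 2 * (L / μ) ^ (5 / 2 : ℝ)))
        (x0 : SClip.Vec d) (i : Fin n),
        -- the mean squared errors are finite, and they vanish at the claimed rate
        let err : ℕ → Ω → ℝ := fun t ω =>
          ‖(SClip.run W f (SClip.phi cφ) (SClip.eps τ) (SClip.beta cβ) (SClip.eta cη) x0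
              (fun s j => ξ s j ω) t).x i - xstar‖ ^ 2
        (∀ t, Integrable (err t) P) ∧
        ∀ δ : ℝ, 0 < δ → δ < min (cs d (L / μ)) (2 / 5) →
          Tendsto (fun t : ℕ => ((t : ℝ) + 1) ^ δ * ∫ ω, err t ω ∂P) atTop (𝓝 0) := by
  intro a A b B ha haA hb hbB hAb
  have hB : 0 < B := hb.trans_le hbB
  refine ⟨fun d κ => 1 / 10 * √(a / B) * (d : ℝ) ^ (-(1 / 2) : ℝ) * κ ^ (-(5 / 4) : ℝ),
    ⟨1 / 10 * √(a / B), by positivity, fun d κ _ _ => le_rfl⟩, ?_⟩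
  intro n d hd f μ L hμ hL hf xstar hmin cstar hc Ω _ P _ ξ p σ hσ hξ G W hW cφ τ cβ cη hφ hη
    hβ0 hβ1 hXa hXA hτb hτB x0 i
  have hn : 0 < n := i.pos
  have hd0 : 0 < d := hd
  have hd' : (0 : ℝ) < d := by exact_mod_cast hd0
  have hL0 : 0 < L := hμ.trans_le hL
  have hτ : 0 < τ := lt_of_lt_of_le (by positivity) hτb
  have hdist := SClip.clipping_distortion_le hb hAb hμ hL hσ hd' hXA hτb
  have hrate := SClip.rate_le_effective_step (C := cη * cφ) ha hB hμ hL hσ hd' (by positivity)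
    (by rwa [mul_pow]) hτ hτB
  obtain ⟨C, T, hC0, hrec⟩ := SClip.exists_recursion (x0 := x0) hn hd0 hμ hL hf hmin hc hξ hW hφ
    hτ hη hβ0 hβ1 hdist
  obtain ⟨K, hK0, hK⟩ := SClip.exists_abs_x_sub_nodeMean_le (f := f) (x0 := x0) hn hW hφ hτ hη
    hβ0 hβ1
  obtain ⟨B', hB'⟩ := SClip.exists_abs_nodeMean_sub_le (f := f) (x0 := x0) hn
    hW.doubly_stochastic hφ hτ hη hβ0 hβ1 xstar
  intro err
  set S : ℕ → Ω → SClip.State n d := fun t ω => SClip.run W f (SClip.phi cφ) (SClip.eps τ)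
    (SClip.beta cβ) (SClip.eta cη) x0 (fun s j => ξ s j ω) t with hS
  set V : ℕ → ℝ := fun t => ∫ ω, ‖SClip.nodeMean (S t ω).x - xstar‖ ^ 2 ∂P with hV
  have hNm : Measurable fun ω (s : ℕ) (j : Fin n) => ξ s j ω :=
    measurable_pi_lambda _ fun s => measurable_pi_lambda _ fun j => hξ.measurable_noise s j
  have hxm : ∀ t j, Measurable fun ω => (S t ω).x j := fun t j =>
    ((SClip.measurable_run fun i => (hf i).measurable_gradient) t |>.1 j).comp hNm
  have hmeanm : ∀ t, Measurable fun ω => SClip.nodeMean (S t ω).x := fun t =>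
    (Finset.measurable_sum _ fun j _ => hxm t j).const_smul (1 / (n : ℝ))
  have hmean : ∀ t ω, ‖SClip.nodeMean (S t ω).x - xstar‖
      ≤ √d * (|B'| + 10 / 3 * (cη * cφ) * ((t : ℝ) + 1) ^ (3 / 10 : ℝ)) := fun t ω =>
    SClip.norm_le_sqrt_mul (by positivity) fun k =>
      (hB' (fun s j => ξ s j ω) t k).trans (add_le_add (le_abs_self B') le_rfl)
  have hdis : ∀ t ω, ‖(S t ω).x i - SClip.nodeMean (S t ω).x‖
      ≤ √d * (K * ((t : ℝ) + 1) ^ (-(7 / 10) : ℝ)) := fun t ω =>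
    SClip.norm_le_sqrt_mul (by positivity) fun k => hK (fun s j => ξ s j ω) t i k
  have herr : ∀ t ω, err t ω ≤ 2 * (√d * (K * ((t : ℝ) + 1) ^ (-(7 / 10) : ℝ))) ^ 2
      + 2 * ‖SClip.nodeMean (S t ω).x - xstar‖ ^ 2 := by
    intro t ω
    have h1 : ‖(S t ω).x i - xstar‖ ≤ ‖(S t ω).x i - SClip.nodeMean (S t ω).x‖
        + ‖SClip.nodeMean (S t ω).x - xstar‖ := by
      simpa using norm_add_le ((S t ω).x i - SClip.nodeMean (S t ω).x)
        (SClip.nodeMean (S t ω).x - xstar)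
    have h2 : ‖(S t ω).x i - xstar‖ ^ 2 ≤ (√d * (K * ((t : ℝ) + 1) ^ (-(7 / 10) : ℝ))
        + ‖SClip.nodeMean (S t ω).x - xstar‖) ^ 2 := by
      gcongr
      exact h1.trans (add_le_add (hdis t ω) le_rfl)
    have h3 := sq_nonneg (√d * (K * ((t : ℝ) + 1) ^ (-(7 / 10) : ℝ))
      - ‖SClip.nodeMean (S t ω).x - xstar‖)
    change ‖(S t ω).x i - xstar‖ ^ 2 ≤ _
    linarith
  have herr0 : ∀ t ω, 0 ≤ err t ω := fun t ω => sq_nonneg _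
  have hVint : ∀ t, Integrable (fun ω => ‖SClip.nodeMean (S t ω).x - xstar‖ ^ 2) P := fun t =>
    Integrable.of_bound (((hmeanm t).sub_const xstar).norm.pow_const 2).aestronglyMeasurable
      ((√d * (|B'| + 10 / 3 * (cη * cφ) * ((t : ℝ) + 1) ^ (3 / 10 : ℝ))) ^ 2)
      (ae_of_all _ fun ω => by
        simp only [norm_pow, norm_norm]
        gcongr
        exact hmean t ω)
  have hdom : ∀ t : ℕ, Integrable (fun ω => 2 * (√d * (K * ((t : ℝ) + 1) ^ (-(7 / 10) : ℝ))) ^ 2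
      + 2 * ‖SClip.nodeMean (S t ω).x - xstar‖ ^ 2) P := fun t =>
    (integrable_const _).add ((hVint t).const_mul 2)
  have hint : ∀ t, Integrable (err t) P := fun t =>
    (hdom t).mono' (((hxm t i).sub_const xstar).norm.pow_const 2).aestronglyMeasurable
      (ae_of_all _ fun ω => by
        rw [Real.norm_of_nonneg (herr0 t ω)]
        exact herr t ω)
  refine ⟨hint, fun δ hδ0 hδ => ?_⟩
  have hδc : δ < min (μ * (cη * cφ / √τ) / 10) (2 / 5) := by
    refine lt_min ((hδ.trans_le (min_le_left _ _)).trans_le ?_) (hδ.trans_le (min_le_right _ _))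
    linarith
  have hVlim := SClip.tendsto_of_recursion (V := V)
    (fun t => integral_nonneg fun ω => sq_nonneg _) hC0 hrec hδ0 hδc
  have hδ5 : δ < 2 / 5 := hδ.trans_le (min_le_right _ _)
  have hlim : Tendsto (fun t : ℕ => 2 * (√d * K) ^ 2 * ((t : ℝ) + 1) ^ (-(7 / 5 - δ))
      + 2 * (((t : ℝ) + 1) ^ δ * V t)) atTop (𝓝 0) := by
    simpa using ((SClip.tendsto_rpow_neg (by linarith : 0 < 7 / 5 - δ)).const_mul
      (2 * (√d * K) ^ 2)).add (hVlim.const_mul 2)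
  refine squeeze_zero (fun t => mul_nonneg (by positivity) (integral_nonneg (herr0 t)))
    (fun t => ?_) hlim
  have hs : (0 : ℝ) < (t : ℝ) + 1 := by positivity
  have h1 : ∫ ω, err t ω ∂P
      ≤ 2 * (√d * (K * ((t : ℝ) + 1) ^ (-(7 / 10) : ℝ))) ^ 2 + 2 * V t := by
    have h2 := integral_mono (hint t) (hdom t) (herr t)
    rw [integral_add (integrable_const _) ((hVint t).const_mul 2)] at h2
    simpa only [integral_const, probReal_univ, one_smul, integral_const_mul] using h2
  have e : ((t : ℝ) + 1) ^ (-(7 / 5 - δ))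
      = ((t : ℝ) + 1) ^ δ * (((t : ℝ) + 1) ^ (-(7 / 10) : ℝ)) ^ 2 := by
    rw [← Real.rpow_natCast, ← Real.rpow_mul hs.le, ← Real.rpow_add hs]
    congr 1
    norm_num
    ring
  rw [e]
  refine (mul_le_mul_of_nonneg_left h1 (by positivity)).trans (le_of_eq ?_)
  ring
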